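/- **Theorem 6.1.** Let $\Lambda$ be the algebra of symmetric functions over $\mathbb R$, freely generated by the Newton power sums $p_1,p_2,\dots$, let $\Lambda^\circ=\Lambda/(p_1-1)$ be its quotient by the ideal generated by $p_1-1$, and denote by $f\mapsto f^\circ$ the canonical projection $\Lambda\to\Lambda^\circ$. Let $s_\mu\in\Lambda$ be the Schur function of a Young diagram $\mu$, and write $|\mu|$ for the number of boxes of $\mu$. For $\nu\subset\mu$ set $$(z)_{\mu/\nu}=\prod_{(i,j)\in\mu/\nu}(z+j-i),$$ where $(i,j)$ is the box in row $i$ and column $j$; write $\nu\nearrow\mu$ if $\nu$ is obtained from $\mu$ by removing one box. Let $z,z'\in\mathbb C$ be such that $z+z'$ and $zz'$ are real (in particular, $(z,z')$ may be any pair of the principal series, $z'=\bar z\in\mathbb C\setminus\mathbb R$, or of the complementary series, $z,z'\in(N,N+1)$ for some $N\in\mathbb Z$). There is exactly one linear operator $A_{z,z'}:\Lambda^\circ\to\Lambda^\circ$ such that for every Young diagram $\mu$, with $m=|\mu|$, $$A_{z,z'}\,s_\mu^\circ=-m(m-1+zz')\,s_\mu^\circ+\sum_{\nu\nearrow\mu}(z)_{\mu/\nu}(z')_{\mu/\nu}\,s_\nu^\circ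 .$$ Identify $\Lambda^\circ$ with the polynomial algebra $\mathbb R[q_1,q_2,\dots]$ in the moment coordinates $q_k=p^\circ_{k+1}$, $k\ge1$, and put $q_0=1$. Then $$\begin{aligned}A_{z,z'}={}&\sum_{i,j=1}^\infty (i+1)(j+1)(q_{i+j}-q_iq_j)\frac{\partial^2}{\partial q_i\,\partial q_j}-zz'\sum_{i=1}^\infty(i+1)q_i\frac{\partial}{\partial q_i}+(z+z')\sum_{i=1}^\infty(i+1)q_{i-1}\frac{\partial}{\partial q_i}\\&+\sum_{i,j=0}^\infty(i+j+3)\,q_iq_j\frac{\partial}{\partial q_{i+j+2}}-\sum_{i=1}^\infty(i+1)i\,q_i\frac{\partial}{\partial q_i}.\end{aligned}\tag{6.1}$$ (Applied to a polynomial, each of these sums has only finitely many nonzero terms.) -/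

import Mathlib

namespace ThomaDiffusion

open MvPolynomial

noncomputable section

/-! ## The algebra of symmetric functions and its quotient -/

/-- The algebra of symmetric functions over `ℝ`, presented as the commutative algebra freely
generated by the Newton power sums `p_1, p_2, …`. -/
abbrev SymAlg : Type := MvPolynomial ℕ+ ℝ

/-- The Newton power sum `p_k`, `k ≥ 1`. -/
def powerSum (k : ℕ+) : SymAlg := X k

/-- The complete homogeneous symmetric functions `h_n`, determined by `h_0 = 1` and Newton's
identities `n h_n = p_1 h_{n-1} + p_2 h_{n-2} + ⋯ + p_n h_0`. -/
def complete : ℕ → SymAlg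
  | 0 => 1
  | n + 1 => C ((n + 1 : ℝ)⁻¹) * ∑ k : Fin (n + 1), powerSum k.1.succPNat * complete (n - k.1)

/-- `h_n` for an integer index, with `h_n = 0` for `n < 0`. -/
def completeInt (n : ℤ) : SymAlg := if n < 0 then 0 else complete n.toNat

/-- The Schur function `s_μ = det [h_{μ_i - i + j}]`, where `i, j` range over the nonempty rows
of `μ` (whose number is the length of the first column). -/
def schur (μ : YoungDiagram) : SymAlg :=
  Matrix.det (Matrix.of fun i j : Fin (μ.colLen 0) =>
    completeInt ((μ.rowLen i : ℤ) - (i : ℤ) + (j : ℤ)))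

/-- The principal ideal generated by `p_1 - 1`. -/
def circIdeal : Ideal SymAlg := Ideal.span {powerSum 1 - 1}

/-- The quotient of the algebra of symmetric functions by the ideal generated by `p_1 - 1`. -/
abbrev SymCirc : Type := SymAlg ⧸ circIdeal

/-- The canonical projection `f ↦ f°`. -/
def circ : SymAlg →ₐ[ℝ] SymCirc := Ideal.Quotient.mkₐ ℝ circIdeal

/-! ## Young diagrams with one box removed

A cell `(i, j)` of a `YoungDiagram` has row number `i` and column number `j`, both counted
from `0`; this does not affect the content `j - i`. -/

theorem finite_removeBox (μ : YoungDiagram) :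
    {ν : YoungDiagram | ν ≤ μ ∧ μ.card = ν.card + 1}.Finite := by
  have hinj : Function.Injective YoungDiagram.cells := by
    intro a b h
    ext x
    rw [h]
  refine ((Finset.finite_toSet μ.cells.powerset).preimage hinj.injOn).subset ?_
  rintro ν ⟨hν, -⟩
  simpa using hν

/-- The finite set of the diagrams `ν` obtained from `μ` by removing one box. -/
def removeBox (μ : YoungDiagram) : Finset YoungDiagram := (finite_removeBox μ).toFinset

/-- `(z)_{μ/ν}`: the product of `z + j - i` over the boxes `(i, j)` of `μ` not in `ν`. -/
def contentProd (z : ℂ) (μ ν : YoungDiagram) : ℂ :=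
  ∏ c ∈ μ.cells \ ν.cells, (z + (c.2 : ℂ) - (c.1 : ℂ))

/-! ## The operator -/

/-- The linear operator `A` on the quotient algebra acts on the images of all Schur functions by
`A s°_μ = -m (m - 1 + z z') s°_μ + ∑_{ν ↗ μ} (z)_{μ/ν} (z')_{μ/ν} s°_ν`, where `m = |μ|`.
The numerical coefficients are real numbers as soon as `z + z'` and `z z'` are real;
the real part only serves to regard them as elements of `ℝ`. -/
def IsPreGenerator (z z' : ℂ) (A : SymCirc →ₗ[ℝ] SymCirc) : Prop :=
  ∀ μ : YoungDiagram,
    A (circ (schur μ)) =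
      (-((μ.card : ℝ) * ((μ.card : ℝ) - 1 + (z * z').re))) • circ (schur μ) +
        ∑ ν ∈ removeBox μ, (contentProd z μ ν * contentProd z' μ ν).re • circ (schur ν)

/-! ## Moment coordinates -/

/-- The algebra `ℝ[q_1, q_2, …]` of polynomials in the moment coordinates. -/
abbrev MomentAlg : Type := MvPolynomial ℕ+ ℝ

/-- The moment coordinate `q_k`, with the convention `q_0 = 1`. -/
def q : ℕ → MomentAlg
  | 0 => 1
  | k + 1 => X k.succPNat

theorem circ_powerSum_one : circ (powerSum 1) = 1 := by
  have h : circ (powerSum 1 - 1) = 0 :=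
    Ideal.Quotient.eq_zero_iff_mem.mpr (Ideal.subset_span rfl)
  rwa [map_sub, map_one, sub_eq_zero] at h

/-- The algebra homomorphism `q_k ↦ p°_{k+1}`, `k ≥ 1`. -/
def momentHom : MomentAlg →ₐ[ℝ] SymCirc := aeval fun k : ℕ+ => circ (powerSum (k + 1))

/-- The algebra homomorphism `p°_k ↦ q_{k-1}`, `k ≥ 1`, in the opposite direction. -/
def momentInv : SymCirc →ₐ[ℝ] MomentAlg :=
  Ideal.Quotient.liftₐ circIdeal (aeval fun k : ℕ+ => q k.natPred) (by
    intro a ha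
    have hle : circIdeal ≤ RingHom.ker
        (aeval fun k : ℕ+ => q k.natPred : SymAlg →ₐ[ℝ] MomentAlg) := by
      rw [circIdeal, Ideal.span_le, Set.singleton_subset_iff]
      simp [RingHom.mem_ker, powerSum, q, PNat.natPred]
    exact hle ha)

theorem momentHom_q (k : ℕ) : momentHom (q k) = circ (powerSum k.succPNat) := by
  cases k with
  | zero =>
    rw [q, map_one]
    exact circ_powerSum_one.symm
  | succ k =>
    rw [q, momentHom, aeval_X]
    rfl

theorem momentInv_circ (k : ℕ+) : momentInv (circ (powerSum k)) = q k.natPred := by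
  change aeval (fun k : ℕ+ => q k.natPred) (X k : SymAlg) = _
  rw [aeval_X]

/-- The algebra isomorphism from `ℝ[q_1, q_2, …]` onto the quotient algebra that is given by
`q_k ↦ p°_{k+1}`. -/
def momentEquiv : MomentAlg ≃ₐ[ℝ] SymCirc :=
  AlgEquiv.ofAlgHom momentHom momentInv
    (by
      apply Ideal.Quotient.algHom_ext
      apply MvPolynomial.algHom_ext
      intro k
      change momentHom (momentInv (circ (powerSum k))) = circ (powerSum k)
      rw [momentInv_circ, momentHom_q, PNat.succPNat_natPred])
    (by
      apply MvPolynomial.algHom_ext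
      intro k
      have hX : (X k : MomentAlg) = q k := by
        conv_lhs => rw [← PNat.succPNat_natPred k]
        rw [← PNat.natPred_add_one k]
        rfl
      change momentInv (momentHom (X k)) = X k
      rw [hX, momentHom_q, momentInv_circ, Nat.natPred_succPNat])

/-- The isomorphism sends `q_k` to `p°_{k+1}` for all `k ≥ 0` (in particular `p°_1 = 1`). -/
theorem momentEquiv_q (k : ℕ) : momentEquiv (q k) = circ (powerSum k.succPNat) :=
  momentHom_q k

/-- The differential operator in the moment coordinates. Applied to a polynomial `F`, each of the
sums has only finitely many nonzero terms, see the lemmas below. -/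
def diffOp (z z' : ℂ) (F : MomentAlg) : MomentAlg :=
  (∑ᶠ ij : ℕ+ × ℕ+,
      (((ij.1 : ℝ) + 1) * ((ij.2 : ℝ) + 1)) •
        ((q (ij.1 + ij.2) - q ij.1 * q ij.2) * pderiv ij.1 (pderiv ij.2 F)))
    - (z * z').re • (∑ᶠ i : ℕ+, ((i : ℝ) + 1) • (q i * pderiv i F))
    + (z + z').re • (∑ᶠ i : ℕ+, ((i : ℝ) + 1) • (q ((i : ℕ) - 1) * pderiv i F))
    + (∑ᶠ ij : ℕ × ℕ,
        ((ij.1 : ℝ) + (ij.2 : ℝ) + 3) •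
          (q ij.1 * q ij.2 * pderiv (ij.1 + ij.2 + 1).succPNat F))
    - (∑ᶠ i : ℕ+, (((i : ℝ) + 1) * (i : ℝ)) • (q i * pderiv i F))

theorem finite_pderiv (F : MomentAlg) : {i : ℕ+ | pderiv i F ≠ 0}.Finite := by
  refine F.vars.finite_toSet.subset fun i hi => ?_
  by_contra h
  exact hi (pderiv_eq_zero_of_notMem_vars h)

theorem finite_support_second (c : ℕ+ × ℕ+ → ℝ) (g : ℕ+ × ℕ+ → MomentAlg) (F : MomentAlg) :
    (Function.support fun ij : ℕ+ × ℕ+ =>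
      c ij • (g ij * pderiv ij.1 (pderiv ij.2 F))).Finite := by
  refine ((finite_pderiv F).biUnion
    (fun j _ => (finite_pderiv (pderiv j F)).image fun i => (i, j))).subset ?_
  rintro ⟨i, j⟩ h
  have h1 : pderiv i (pderiv j F) ≠ 0 := fun h0 => h (by simp [h0])
  have h2 : pderiv j F ≠ 0 := fun h0 => h1 (by simp [h0])
  simpa using And.intro h1 h2

theorem finite_support_first (c : ℕ+ → ℝ) (g : ℕ+ → MomentAlg) (F : MomentAlg) :
    (Function.support fun i : ℕ+ => c i • (g i * pderiv i F)).Finite := by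
  refine (finite_pderiv F).subset fun i h h0 => h ?_
  simp [h0]

theorem finite_support_quadratic (c : ℕ × ℕ → ℝ) (g : ℕ × ℕ → MomentAlg) (F : MomentAlg) :
    (Function.support fun ij : ℕ × ℕ =>
      c ij • (g ij * pderiv (ij.1 + ij.2 + 1).succPNat F)).Finite := by
  refine ((finite_pderiv F).biUnion (fun k _ =>
    (Finset.range (k : ℕ) ×ˢ Finset.range (k : ℕ)).finite_toSet)).subset ?_
  rintro ⟨i, j⟩ h
  have h1 : pderiv (i + j + 1).succPNat F ≠ 0 := fun h0 => h (by simp [h0])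
  refine Set.mem_biUnion (x := (i + j + 1).succPNat) h1 ?_
  simp
  omega

end

end ThomaDiffusion

namespace ThomaDiffusion

open MvPolynomial

noncomputable section

/-! ## Second order differential operators on polynomial algebras -/

section SecondOrder

variable {σ : Type*}

/-! Write E for the Euler operator `p_k ↦ k p_k`, s = z + z', t = zz' and π(w) = w² + sw + t. The
operator is realised before passing to the quotient, as L − E² + (1 − t)E on Λ. Here L = `lowering s
t` is an explicit second order operator in the power sums that removes boxes with weight π(content).
Since E multiplies s_μ by m = |μ|, the other two terms give −m(m − 1 + t).

The action of L on Schur functions comes from Bernstein operators B_m, which build Jacobi–Trudi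
determinants row by row (`jacobiTrudi_succ`). The key relation is `lowering_bernstein`: L_{s,t} B_m
= B_m L_{s−2,t−s+1} + π(m − 1) B_{m−1}, where the new parameters amount to replacing w by w − 1 in
π. Iterating it lowers each row index of the determinant in turn. If the result is not the shape of
a diagram, two rows coincide and the determinant vanishes, so exactly the removable boxes survive
(`lowering_schur`).

Setting p_1 = 1 and p_{k+1} = q_k turns L − E² + (1 − t)E into (6.1): both sides have the same value
on constants and obey compatible rules under multiplication by a power sum (`specialize_lift`). Thus
the differential operator itself proves existence. Uniqueness needs only that Schur functions span Λ
(`span_schur_eq_top`), not that they are independent. -/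

theorem finite_support_pderiv_pderiv (c : σ → σ → MvPolynomial σ ℝ) (F : MvPolynomial σ ℝ) :
    (Function.support fun ij : σ × σ => c ij.1 ij.2 * pderiv ij.1 (pderiv ij.2 F)) ⊆
      ((F.vars ×ˢ F.vars : Finset (σ × σ)) : Set (σ × σ)) := by
  classical
  rintro ⟨i, j⟩ h
  have h2 : j ∈ F.vars := by
    by_contra h0
    exact h (by simp [pderiv_eq_zero_of_notMem_vars h0])
  have h1 : i ∈ F.vars := by
    by_contra h0
    refine h ?_
    -- Partial derivatives commute because their commutator is a derivation that kills every
    -- variable.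
    have : pderiv i (pderiv j F) = pderiv j (pderiv i F) := by
      have := congrArg (fun d : Derivation ℝ _ _ => d F)
        (show ⁅(pderiv i : Derivation ℝ (MvPolynomial σ ℝ) _), pderiv j⁆ = 0 by
          apply MvPolynomial.derivation_ext
          intro k
          by_cases hk : k = i <;> by_cases hk' : k = j <;>
            simp [Derivation.commutator_apply, pderiv_X, Pi.single_apply, hk, hk'] <;>
            split_ifs <;> simp)
      simpa [Derivation.commutator_apply, sub_eq_zero] using this
    simp [this, pderiv_eq_zero_of_notMem_vars h0]
  simp [h1, h2]

/-- The operator `∑ c_{ij} ∂_i ∂_j`. -/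
def secondOrder (c : σ → σ → MvPolynomial σ ℝ) :
    MvPolynomial σ ℝ →ₗ[ℝ] MvPolynomial σ ℝ where
  toFun F := ∑ᶠ ij : σ × σ, c ij.1 ij.2 * pderiv ij.1 (pderiv ij.2 F)
  map_add' F G := by
    rw [← finsum_add_distrib ((Finset.finite_toSet _).subset (finite_support_pderiv_pderiv c F))
      ((Finset.finite_toSet _).subset (finite_support_pderiv_pderiv c G))]
    simp [mul_add]
  map_smul' r F := by
    rw [RingHom.id_apply, smul_finsum' r
      ((Finset.finite_toSet _).subset (finite_support_pderiv_pderiv c F))]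
    simp

theorem secondOrder_apply (c : σ → σ → MvPolynomial σ ℝ) (F : MvPolynomial σ ℝ) :
    secondOrder c F = ∑ᶠ ij : σ × σ, c ij.1 ij.2 * pderiv ij.1 (pderiv ij.2 F) := rfl

theorem secondOrder_eq_sum (c : σ → σ → MvPolynomial σ ℝ) (F : MvPolynomial σ ℝ) (s : Finset σ)
    (hs : F.vars ⊆ s) :
    secondOrder c F = ∑ i ∈ s, ∑ j ∈ s, c i j * pderiv i (pderiv j F) := by
  rw [secondOrder_apply, finsum_eq_sum_of_support_subset (s := s ×ˢ s), Finset.sum_product]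
  refine (finite_support_pderiv_pderiv c F).trans ?_
  exact_mod_cast Finset.product_subset_product hs hs

theorem derivation_sum_apply {ι : Type*} (D : ι → Derivation ℝ (MvPolynomial σ ℝ) (MvPolynomial σ ℝ))
    (s : Finset ι) (F : MvPolynomial σ ℝ) : (∑ i ∈ s, D i) F = ∑ i ∈ s, D i F := by
  classical
  induction s using Finset.induction_on with
  | empty => simp
  | insert a s ha ih => rw [Finset.sum_insert ha, Finset.sum_insert ha, Derivation.add_apply, ih]

theorem mkDerivation_eq_sum (w : σ → MvPolynomial σ ℝ) (F : MvPolynomial σ ℝ) (s : Finset σ)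
    (hs : F.vars ⊆ s) : mkDerivation ℝ w F = ∑ i ∈ s, w i * pderiv i F := by
  classical
  have h := derivation_eq_of_forall_mem_vars (D₁ := mkDerivation ℝ w)
    (D₂ := ∑ i ∈ s, w i • (pderiv i : Derivation ℝ (MvPolynomial σ ℝ) _)) (f := F) (by
      intro i hi
      rw [mkDerivation_X, derivation_sum_apply, Finset.sum_eq_single i]
      · simp
      · intro j _ hj
        simp [pderiv_X, hj.symm]
      · exact fun h => absurd (hs hi) h)
  rw [h, derivation_sum_apply]
  simp

theorem secondOrder_C (c : σ → σ → MvPolynomial σ ℝ) (a : ℝ) : secondOrder c (C a) = 0 := by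
  simp [secondOrder_apply]

/-- The cross terms of the Leibniz rule form a derivation, counted twice by symmetry of `c`. With
the values on constants, this rule determines the operator by induction on polynomials. -/
theorem secondOrder_mul_X (c : σ → σ → MvPolynomial σ ℝ) (hc : ∀ i j, c i j = c j i)
    (F : MvPolynomial σ ℝ) (n : σ) :
    secondOrder c (F * X n) = X n * secondOrder c F + 2 * mkDerivation ℝ (c n) F := by
  classical
  have hn : n ∈ insert n F.vars := Finset.mem_insert_self _ _
  have hF : F.vars ⊆ insert n F.vars := Finset.subset_insert _ _
  rw [secondOrder_eq_sum c (F * X n) (insert n F.vars), secondOrder_eq_sum c F _ hF,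
    mkDerivation_eq_sum _ F _ hF]
  · have h1 : ∀ i j, c i j * pderiv i (pderiv j (F * X n)) =
        X n * (c i j * pderiv i (pderiv j F)) + (if i = n then c n j * pderiv j F else 0)
          + (if j = n then c n i * pderiv i F else 0) := by
      intro i j
      have hX : ∀ k, pderiv k (X n : MvPolynomial σ ℝ) = if k = n then 1 else 0 := by
        intro k
        rw [pderiv_X, Pi.single_apply]
        simp only [eq_comm]
      simp only [Derivation.leibniz, map_add, smul_eq_mul, hX]
      by_cases hi : i = n <;> by_cases hj : j = n <;>
        simp only [hi, hj, hc _ n, if_true, if_false, map_zero,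
          Derivation.map_one_eq_zero] <;> ring
    simp only [h1, Finset.sum_add_distrib, Finset.mul_sum, Finset.sum_ite_eq', hn, if_true]
    rw [Finset.sum_comm (f := fun i j => if i = n then c n j * pderiv j F else 0)]
    simp only [Finset.sum_ite_eq', hn, if_true, two_mul, add_assoc, Finset.sum_add_distrib]
  · refine (vars_mul _ _).trans (Finset.union_subset hF ?_)
    rw [vars_X]
    simp

end SecondOrder

/-! ## Generating series -/

section Euler

variable {R : Type*} [CommRing R]

/-- The Euler derivation `x d/dx` on formal power series. -/
def eulerSeries : Derivation R (PowerSeries R) (PowerSeries R) :=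
  (PowerSeries.X : PowerSeries R) • PowerSeries.derivative R

theorem coeff_eulerSeries (F : PowerSeries R) (n : ℕ) :
    PowerSeries.coeff n (eulerSeries F) = n * PowerSeries.coeff n F := by
  rw [eulerSeries, Derivation.smul_apply, smul_eq_mul]
  cases n with
  | zero => simp
  | succ n =>
    rw [PowerSeries.coeff_succ_X_mul, PowerSeries.coeff_derivative]
    push_cast
    ring

/-- A solution of `x Z' = P Z + G` with `P(0) = 0` is determined by its constant term. -/
theorem eulerSeries_unique [Algebra ℝ R] {P G Z₁ Z₂ : PowerSeries R}
    (hP : PowerSeries.coeff 0 P = 0)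
    (h₁ : eulerSeries Z₁ = P * Z₁ + G) (h₂ : eulerSeries Z₂ = P * Z₂ + G)
    (h₀ : PowerSeries.coeff 0 Z₁ = PowerSeries.coeff 0 Z₂) : Z₁ = Z₂ := by
  ext n
  induction n using Nat.strong_induction_on with
  | _ n ih =>
  cases n with
  | zero => exact h₀
  | succ n =>
    have e : ((n + 1 : ℕ) : R) * PowerSeries.coeff (n + 1) Z₁ =
        ((n + 1 : ℕ) : R) * PowerSeries.coeff (n + 1) Z₂ := by
      rw [← coeff_eulerSeries, ← coeff_eulerSeries, h₁, h₂, map_add, map_add,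
        PowerSeries.coeff_mul, PowerSeries.coeff_mul]
      congr 1
      refine Finset.sum_congr rfl fun x hx => ?_
      rcases Nat.eq_zero_or_pos x.1 with h | h
      · rw [h, hP, zero_mul, zero_mul]
      · rw [ih x.2 (by have := Finset.HasAntidiagonal.mem_antidiagonal.mp hx; omega)]
    -- The equation gives the coefficient only up to the factor n + 1, which is invertible in an
    -- ℝ-algebra.
    have hu : IsUnit ((n + 1 : ℕ) : R) := by
      have : IsUnit ((n + 1 : ℕ) : ℝ) := by
        rw [isUnit_iff_ne_zero]
        positivity
      simpa using this.map (algebraMap ℝ R)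
    exact hu.mul_left_cancel e

end Euler

/-- The power sums indexed by `ℕ`, with `p_0` replaced by `0`. -/
def psum : ℕ → SymAlg
  | 0 => 0
  | k + 1 => X k.succPNat

theorem psum_coe (n : ℕ+) : psum n = X n := by
  conv_lhs => rw [← PNat.natPred_add_one n]
  rw [psum, PNat.succPNat_natPred]

theorem complete_newton (n : ℕ) :
    (n : SymAlg) * complete n =
      ∑ x ∈ Finset.HasAntidiagonal.antidiagonal n, psum x.1 * complete x.2 := by
  cases n with
  | zero => simp [psum]
  | succ n =>
    rw [Finset.Nat.sum_antidiagonal_eq_sum_range_succ_mk, Finset.sum_range_succ', complete,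
      ← mul_assoc]
    have : ((n + 1 : ℕ) : SymAlg) * C ((n + 1 : ℝ)⁻¹) = 1 := by
      rw [← map_natCast (C : ℝ →+* SymAlg), ← C_mul, ← C_1]
      congr 1
      push_cast
      exact mul_inv_cancel₀ (by positivity)
    rw [this, one_mul, Finset.sum_range]
    simp [psum, powerSum]

/-- The generating series of the power sums. -/
def psumSeries : PowerSeries SymAlg := PowerSeries.mk psum

/-- The generating series of the complete homogeneous symmetric functions. -/
def completeSeries : PowerSeries SymAlg := PowerSeries.mk complete

theorem eulerSeries_completeSeries :
    eulerSeries completeSeries = psumSeries * completeSeries := by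
  ext1 n
  rw [coeff_eulerSeries, PowerSeries.coeff_mul]
  simp only [completeSeries, psumSeries, PowerSeries.coeff_mk]
  exact complete_newton n

theorem complete_zero : complete 0 = 1 := by rw [complete]

/-- A derivation with `D p_n = n w_n` multiplies the series `∑ h_n x^n` by `∑ w_n x^n`. -/
theorem derivation_complete (D : Derivation ℝ SymAlg SymAlg) (W : PowerSeries SymAlg)
    (hW : ∀ n : ℕ, D (psum n) = n * PowerSeries.coeff n W) (hW0 : PowerSeries.coeff 0 W = 0) :
    PowerSeries.mk (fun n => D (complete n)) = W * completeSeries := by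
  -- With θ = x d/dx, applying `D` to Newton's identities gives θZ = PZ + (θW)H. The product WH
  -- satisfies the same equation because θH = PH.
  refine eulerSeries_unique (P := psumSeries) (G := eulerSeries W * completeSeries) ?_ ?_ ?_ ?_
  · simp [psumSeries, psum]
  · ext1 n
    rw [coeff_eulerSeries, map_add, PowerSeries.coeff_mul, PowerSeries.coeff_mul,
      PowerSeries.coeff_mk]
    have h := congrArg D (complete_newton n)
    rw [Derivation.leibniz, Derivation.map_natCast, smul_zero, add_zero, map_sum] at h
    rw [← smul_eq_mul, h, ← Finset.sum_add_distrib]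
    refine Finset.sum_congr rfl fun x _ => ?_
    rw [Derivation.leibniz, coeff_eulerSeries, ← hW]
    simp only [psumSeries, completeSeries, PowerSeries.coeff_mk, smul_eq_mul]
    ring
  · rw [Derivation.leibniz, eulerSeries_completeSeries]
    simp only [smul_eq_mul]
    ring
  · rw [PowerSeries.coeff_mk, PowerSeries.coeff_mul]
    simp only [Finset.HasAntidiagonal.antidiagonal_zero, Finset.sum_singleton, hW0, zero_mul,
      complete_zero, Derivation.map_one_eq_zero]

/-! ## The operators on the algebra of symmetric functions -/

/-- The coefficients `i j p_{i+j-1}`. -/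
def symCoeff (i j : ℕ+) : SymAlg := ((i : ℝ) * (j : ℝ)) • psum ((i : ℕ) + j - 1)

theorem symCoeff_comm (i j : ℕ+) : symCoeff i j = symCoeff j i := by
  rw [symCoeff, symCoeff, mul_comm, add_comm (i : ℕ)]

/-- The derivation `p_i ↦ n i p_{n+i-1}`. -/
def symDer (n : ℕ+) : Derivation ℝ SymAlg SymAlg := mkDerivation ℝ (symCoeff n)

/-- `n (∑_{i+j=n-1} p_i p_j + s p_{n-1} + t δ_{n,1})`, where `p_0 = 0`. -/
def drift (s t : ℝ) (n : ℕ+) : SymAlg :=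
  (n : ℝ) • (∑ x ∈ Finset.HasAntidiagonal.antidiagonal n.natPred, psum x.1 * psum x.2 +
    s • psum n.natPred + if n.natPred = 0 then C t else 0)

/-- The operator on symmetric functions that sends `s_μ` to
`∑_{ν ↗ μ} (c² + s c + t) s_ν`, where `c` is the content of the removed box. -/
def lowering (s t : ℝ) : SymAlg →ₗ[ℝ] SymAlg :=
  secondOrder symCoeff + (mkDerivation ℝ (drift s t)).toLinearMap

theorem lowering_apply (s t : ℝ) (f : SymAlg) :
    lowering s t f = secondOrder symCoeff f + mkDerivation ℝ (drift s t) f := rfl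

theorem lowering_C (s t a : ℝ) : lowering s t (C a) = 0 := by
  rw [lowering_apply, secondOrder_C, derivation_C, add_zero]

theorem lowering_mul_X (s t : ℝ) (f : SymAlg) (n : ℕ+) :
    lowering s t (f * X n) = X n * lowering s t f + f * drift s t n + 2 * symDer n f := by
  rw [lowering_apply, secondOrder_mul_X _ symCoeff_comm, Derivation.leibniz, mkDerivation_X,
    lowering_apply, symDer]
  simp only [smul_eq_mul]
  ring

/-- The generating series of `p_{i+n-1}`, `i ≥ 1`, times `n`. -/
def symSeries (n : ℕ+) : PowerSeries SymAlg :=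
  PowerSeries.mk fun i => if i = 0 then 0 else (n : SymAlg) * psum (n + i - 1)

theorem symDer_psum (n : ℕ+) (i : ℕ) :
    symDer n (psum i) = i * PowerSeries.coeff i (symSeries n) := by
  rw [symSeries, PowerSeries.coeff_mk]
  cases i with
  | zero => simp [psum]
  | succ i =>
    rw [psum, symDer, mkDerivation_X, symCoeff, if_neg (Nat.succ_ne_zero i), Nat.succPNat_coe,
      smul_eq_C_mul]
    simp
    ring

theorem symDer_complete (n : ℕ+) (m : ℕ) :
    symDer n (complete m) = PowerSeries.coeff m (symSeries n * completeSeries) := by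
  rw [← derivation_complete (symDer n) (symSeries n) (symDer_psum n) (by simp [symSeries]),
    PowerSeries.coeff_mk]

theorem sum_antidiagonal_assoc {M : Type*} [AddCommMonoid M] (n : ℕ) (f : ℕ → ℕ → ℕ → M) :
    ∑ x ∈ Finset.HasAntidiagonal.antidiagonal n,
        ∑ y ∈ Finset.HasAntidiagonal.antidiagonal x.2, f x.1 y.1 y.2 =
      ∑ x ∈ Finset.HasAntidiagonal.antidiagonal n,
        ∑ y ∈ Finset.HasAntidiagonal.antidiagonal x.1, f y.1 y.2 x.2 := by
  rw [Finset.sum_sigma', Finset.sum_sigma']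
  refine Finset.sum_nbij' (fun ⟨⟨i, _⟩, ⟨k, l⟩⟩ => ⟨(i + k, l), (i, k)⟩)
    (fun ⟨⟨_, j⟩, ⟨k, l⟩⟩ => ⟨(k, l + j), (l, j)⟩) ?_ ?_ ?_ ?_ ?_
  · rintro ⟨⟨i, j⟩, ⟨k, l⟩⟩ h
    simp only [Finset.mem_sigma, Finset.HasAntidiagonal.mem_antidiagonal, and_true] at h ⊢
    omega
  · rintro ⟨⟨i, j⟩, ⟨k, l⟩⟩ h
    simp only [Finset.mem_sigma, Finset.HasAntidiagonal.mem_antidiagonal, and_true] at h ⊢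
    omega
  · rintro ⟨⟨i, j⟩, ⟨k, l⟩⟩ h
    simp only [Finset.mem_sigma, Finset.HasAntidiagonal.mem_antidiagonal] at h
    obtain ⟨_, rfl⟩ := h
    rfl
  · rintro ⟨⟨i, j⟩, ⟨k, l⟩⟩ h
    simp only [Finset.mem_sigma, Finset.HasAntidiagonal.mem_antidiagonal] at h
    obtain ⟨_, rfl⟩ := h
    rfl
  · rintro ⟨⟨i, j⟩, ⟨k, l⟩⟩ h
    rfl

/-- The coefficient of `x^i` in `symSeries a`, for a natural index `a`. -/
def symWeight (a i : ℕ) : SymAlg := if i = 0 then 0 else (a : SymAlg) * psum (a + i - 1)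

/-! ### The lowering operator on complete homogeneous functions -/

theorem secondOrder_psum_mul_complete (a b : ℕ) :
    secondOrder symCoeff (psum a * complete b) = psum a * secondOrder symCoeff (complete b) +
      2 * ∑ x ∈ Finset.HasAntidiagonal.antidiagonal b, symWeight a x.1 * complete x.2 := by
  rcases Nat.eq_zero_or_pos a with rfl | ha
  · simp [psum, symWeight]
  · obtain ⟨n, rfl⟩ : ∃ n : ℕ+, (n : ℕ) = a := ⟨⟨a, ha⟩, rfl⟩
    rw [psum_coe, mul_comm, secondOrder_mul_X _ symCoeff_comm]
    change _ + 2 * symDer n (complete b) = _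
    rw [symDer_complete, PowerSeries.coeff_mul]
    simp [symSeries, completeSeries, symWeight]

/-- Both sides equal r(r − 1)p_{r−1}: the power sum index is constant along the antidiagonal, and
only the sum of a < r remains. -/
theorem sum_symWeight (r : ℕ) :
    2 * ∑ x ∈ Finset.HasAntidiagonal.antidiagonal r, symWeight x.1 x.2 =
      PowerSeries.coeff r (PowerSeries.X *
        (eulerSeries psumSeries + eulerSeries (eulerSeries psumSeries))) := by
  cases r with
  | zero => simp [symWeight]
  | succ r =>
    rw [PowerSeries.coeff_succ_X_mul, map_add, coeff_eulerSeries, coeff_eulerSeries,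
      coeff_eulerSeries, psumSeries, PowerSeries.coeff_mk,
      Finset.Nat.sum_antidiagonal_eq_sum_range_succ_mk, Finset.sum_range_succ]
    have h : ∀ a ∈ Finset.range (r + 1), symWeight a (r + 1 - a) = (a : SymAlg) * psum r := by
      intro a ha
      have := Finset.mem_range.mp ha
      rw [symWeight, if_neg (by omega)]
      congr 2
      omega
    have h' : (∑ a ∈ Finset.range (r + 1), (a : SymAlg)) * 2 = (r + 1) * r := by
      have := congrArg (Nat.cast : ℕ → SymAlg) (Finset.sum_range_id_mul_two (r + 1))
      push_cast at this
      simpa using this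
    rw [Finset.sum_congr rfl h, ← Finset.sum_mul]
    simp only [symWeight, Nat.sub_self, if_true, add_zero]
    linear_combination psum r * h'

/-- Applying the operator to Newton's identities gives a first order equation for the left side,
with a source made of the cross terms. The right side solves the same equation. -/
theorem secondOrder_complete :
    PowerSeries.mk (fun n => secondOrder symCoeff (complete n)) =
      PowerSeries.X * eulerSeries psumSeries * completeSeries := by
  have hX : eulerSeries (PowerSeries.X : PowerSeries SymAlg) = PowerSeries.X := by
    rw [eulerSeries, Derivation.smul_apply]
    simp
  refine eulerSeries_unique (P := psumSeries)
    (G := PowerSeries.X * (eulerSeries psumSeries + eulerSeries (eulerSeries psumSeries)) *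
      completeSeries) ?_ ?_ ?_ ?_
  · simp [psumSeries, psum]
  · ext1 n
    rw [coeff_eulerSeries, map_add, PowerSeries.coeff_mul, PowerSeries.coeff_mul,
      PowerSeries.coeff_mk]
    have h := congrArg (secondOrder symCoeff) (complete_newton n)
    rw [map_sum, ← nsmul_eq_mul, map_nsmul, nsmul_eq_mul] at h
    simp only [secondOrder_psum_mul_complete] at h
    rw [h, Finset.sum_add_distrib]
    congr 1
    · simp [psumSeries]
    simp only [← sum_symWeight, completeSeries, PowerSeries.coeff_mk, mul_assoc, Finset.sum_mul]
    rw [← Finset.mul_sum, ← Finset.mul_sum,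
      sum_antidiagonal_assoc n fun a i c => symWeight a i * complete c]
  · rw [Derivation.leibniz, eulerSeries_completeSeries, Derivation.leibniz, hX]
    simp only [smul_eq_mul]
    ring
  · simp only [PowerSeries.coeff_mk, complete_zero, mul_assoc, PowerSeries.coeff_zero_X_mul]
    rw [← C_1, secondOrder_C]

theorem drift_complete (s t : ℝ) :
    PowerSeries.mk (fun n => mkDerivation ℝ (drift s t) (complete n)) =
      PowerSeries.X * (psumSeries * psumSeries + PowerSeries.C (C s) * psumSeries +
        PowerSeries.C (C t)) * completeSeries := by
  refine derivation_complete _ _ (fun n => ?_) (by simp)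
  cases n with
  | zero => simp [psum]
  | succ n =>
    rw [psum, mkDerivation_X, PowerSeries.coeff_succ_X_mul, drift, Nat.natPred_succPNat,
      Nat.succPNat_coe, map_add, map_add, PowerSeries.coeff_mul, PowerSeries.coeff_C_mul,
      PowerSeries.coeff_C, smul_eq_C_mul, smul_eq_C_mul]
    simp [psumSeries]

/-- The value of the content polynomial `w² + s w + t`. -/
def contentPoly (s t : ℝ) (w : ℤ) : ℝ := (w : ℝ) ^ 2 + s * w + t

/-- With θ = x d/dx, the two parts of the operator add up to x(θP + P² + sP + t)H = x(θ² + sθ + t)H,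
because θ²H = (θP + P²)H. On x^n, θ is multiplication by n, which produces the content polynomial
and explains the choice of `drift`. -/
theorem lowering_complete_succ (s t : ℝ) (n : ℕ) :
    lowering s t (complete (n + 1)) = C (contentPoly s t n) * complete n := by
  have h : PowerSeries.mk (fun n => lowering s t (complete n)) =
      PowerSeries.X * (eulerSeries (eulerSeries completeSeries) +
        PowerSeries.C (C s) * eulerSeries completeSeries +
        PowerSeries.C (C t) * completeSeries) := by
    have h1 : PowerSeries.mk (fun n => lowering s t (complete n)) =
        PowerSeries.mk (fun n => secondOrder symCoeff (complete n)) +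
          PowerSeries.mk (fun n => mkDerivation ℝ (drift s t) (complete n)) := by
      ext1 n
      simp [lowering_apply]
    rw [h1, secondOrder_complete, drift_complete, eulerSeries_completeSeries, Derivation.leibniz,
      eulerSeries_completeSeries]
    simp only [smul_eq_mul]
    ring
  have h2 := congrArg (PowerSeries.coeff (n + 1)) h
  rw [PowerSeries.coeff_mk, PowerSeries.coeff_succ_X_mul] at h2
  rw [h2]
  simp only [map_add, coeff_eulerSeries, PowerSeries.coeff_C_mul, completeSeries,
    PowerSeries.coeff_mk, contentPoly, C_mul, C_pow, Int.cast_natCast, map_natCast]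
  ring

/-! ## Complete homogeneous functions with integer index -/

theorem completeInt_natCast (n : ℕ) : completeInt n = complete n := by simp [completeInt]

theorem completeInt_of_neg {n : ℤ} (h : n < 0) : completeInt n = 0 := if_pos h

theorem completeInt_zero : completeInt 0 = 1 := by
  simpa [complete_zero] using completeInt_natCast 0

theorem lowering_completeInt (s t : ℝ) (n : ℤ) :
    lowering s t (completeInt n) = C (contentPoly s t (n - 1)) * completeInt (n - 1) := by
  rcases lt_trichotomy n 0 with h | rfl | h
  · rw [completeInt_of_neg h, completeInt_of_neg (by omega), map_zero, mul_zero]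
  · rw [completeInt_zero, completeInt_of_neg (by omega), ← C_1, lowering_C, mul_zero]
  · obtain ⟨m, rfl⟩ : ∃ m : ℕ, n = (m + 1 : ℕ) := ⟨(n - 1).toNat, by omega⟩
    rw [completeInt_natCast, lowering_complete_succ]
    push_cast
    rw [add_sub_cancel_right, completeInt_natCast]

/-- Terms with negative index vanish, so any upper limit K ≥ n is allowed; this freedom lets the sum
be split at a chosen place. -/
theorem completeInt_newton (n : ℤ) (K : ℕ) (hK : n ≤ K) :
    (n : SymAlg) * completeInt n =
      ∑ k ∈ Finset.range K, psum (k + 1) * completeInt (n - 1 - k) := by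
  rcases lt_or_ge n 0 with h | h
  · rw [completeInt_of_neg h, mul_zero, Finset.sum_eq_zero]
    intro k _
    rw [completeInt_of_neg (by omega), mul_zero]
  · lift n to ℕ using h
    obtain ⟨d, rfl⟩ : ∃ d, K = n + d := ⟨K - n, by omega⟩
    rw [completeInt_natCast, Int.cast_natCast, complete_newton,
      Finset.Nat.sum_antidiagonal_eq_sum_range_succ_mk, Finset.sum_range_succ',
      Finset.sum_range_add]
    rw [Finset.sum_eq_zero (s := Finset.range d)]
    · simp only [psum, zero_mul, add_zero]
      refine Finset.sum_congr rfl fun k hk => ?_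
      have := Finset.mem_range.mp hk
      rw [← completeInt_natCast]
      congr 2
      omega
    · intro k _
      rw [completeInt_of_neg (by push_cast; omega), mul_zero]

/-- The derivative is n ∑_{k≥1} p_{n+k−1} h_{m−k}, which is the tail of Newton's sum for h_{m+n−1}
after its first n − 1 terms. -/
theorem symDer_completeInt (n : ℕ+) (m : ℤ) :
    symDer n (completeInt m) = C (n : ℝ) *
      (((m + n - 1 : ℤ) : SymAlg) * completeInt (m + n - 1) -
        ∑ k ∈ Finset.range (n - 1), psum (k + 1) * completeInt (m + n - 2 - k)) := by
  obtain ⟨r, hr⟩ : ∃ r : ℕ, (n : ℕ) = r + 1 := ⟨n.natPred, (PNat.natPred_add_one n).symm⟩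
  rw [hr, Nat.add_sub_cancel, Nat.cast_succ (R := ℤ)]
  have e1 : m + (r + 1) - 1 = m + r := by ring
  have e2 : m + ((r : ℤ) + 1) - 2 = m + r - 1 := by ring
  rw [e1, e2]
  rcases lt_or_ge m 0 with h | h
  -- For m < 0 the first r terms already exhaust Newton's sum, so the tail is zero.
  · rw [completeInt_newton (m + r) r (by omega), completeInt_of_neg h, map_zero, sub_self,
      mul_zero]
  · lift m to ℕ using h
    rw [completeInt_newton (m + r) (r + m) (by push_cast; omega), Finset.sum_range_add,
      add_sub_cancel_left, completeInt_natCast, symDer_complete, PowerSeries.coeff_mul,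
      Finset.Nat.sum_antidiagonal_eq_sum_range_succ_mk, Finset.sum_range_succ', Finset.mul_sum]
    simp only [symSeries, completeSeries, PowerSeries.coeff_mk, if_true, zero_mul, add_zero]
    refine Finset.sum_congr rfl fun k hk => ?_
    have := Finset.mem_range.mp hk
    rw [if_neg (Nat.succ_ne_zero k), ← completeInt_natCast, hr, mul_assoc]
    rw [map_natCast C, show r + 1 + (k + 1) - 1 = r + k + 1 by omega,
      show (m : ℤ) + r - 1 - ((r + k : ℕ) : ℤ) = ((m - (k + 1) : ℕ) : ℤ) by omega]

/-! ## The Bernstein operators -/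

/-- The algebra homomorphism `p_k ↦ p_k - u^k`. -/
def shiftHom : SymAlg →ₐ[ℝ] Polynomial SymAlg :=
  aeval fun k : ℕ+ => Polynomial.C (X k) - Polynomial.X ^ (k : ℕ)

/-- The linear map `u^i ↦ h_{n+i}`. -/
def evalComplete (n : ℤ) : Polynomial SymAlg →ₗ[SymAlg] SymAlg :=
  Polynomial.lsum fun i => completeInt (n + i) • LinearMap.id

/-- The Bernstein operator, the coefficient of `u^{-n}` in `f ↦ (∑ h_k u^{-k}) f[p_k - u^k]`. -/
def bernstein (n : ℤ) : SymAlg →ₗ[ℝ] SymAlg :=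
  (evalComplete n).restrictScalars ℝ ∘ₗ shiftHom.toLinearMap

theorem bernstein_apply (n : ℤ) (f : SymAlg) : bernstein n f = evalComplete n (shiftHom f) := rfl

theorem evalComplete_monomial (n : ℤ) (i : ℕ) (a : SymAlg) :
    evalComplete n (Polynomial.monomial i a) = completeInt (n + i) * a := by
  rw [evalComplete, Polynomial.lsum_apply, Polynomial.sum_monomial_index] <;> simp

theorem evalComplete_X_pow_mul (n : ℤ) (k : ℕ) (g : Polynomial SymAlg) :
    evalComplete n (Polynomial.X ^ k * g) = evalComplete (n + k) g := by
  induction g using Polynomial.induction_on' with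
  | add f g hf hg => rw [mul_add, map_add, map_add, hf, hg]
  | monomial i a =>
    rw [Polynomial.X_pow_mul_monomial, evalComplete_monomial, evalComplete_monomial]
    congr 2
    push_cast
    ring

theorem bernstein_C (n : ℤ) (a : ℝ) : bernstein n (C a) = C a * completeInt n := by
  rw [bernstein_apply, shiftHom]
  have : aeval (fun k : ℕ+ => Polynomial.C (X k : SymAlg) - Polynomial.X ^ (k : ℕ)) (C a : SymAlg) =
      Polynomial.monomial 0 (C a) := by
    rw [algHom_C]
    rfl
  rw [this, evalComplete_monomial, Nat.cast_zero, add_zero, mul_comm]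

/-- Multiplication by p_k becomes multiplication by p_k − u^k, and u^k raises the index by k.
Commutation relations for `bernstein` follow from this rule by induction on `f`. -/
theorem bernstein_mul_X (n : ℤ) (f : SymAlg) (k : ℕ+) :
    bernstein n (f * X k) = X k * bernstein n f - bernstein (n + k) f := by
  have h : shiftHom (X k) = Polynomial.C (X k) - Polynomial.X ^ (k : ℕ) := by
    rw [shiftHom, aeval_X]
  rw [bernstein_apply, map_mul, h, mul_comm, sub_mul, map_sub, evalComplete_X_pow_mul,
    ← Polynomial.smul_eq_C_mul, map_smul]
  rfl

theorem bernstein_mul_psum (n : ℤ) (f : SymAlg) (j : ℕ) (hj : 0 < j) :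
    bernstein n (f * psum j) = psum j * bernstein n f - bernstein (n + j) f := by
  obtain ⟨k, rfl⟩ : ∃ k : ℕ+, (k : ℕ) = j := ⟨⟨j, hj⟩, rfl⟩
  rw [psum_coe, bernstein_mul_X]

theorem bernstein_C_mul (n : ℤ) (a : ℝ) (f : SymAlg) :
    bernstein n (C a * f) = C a * bernstein n f := by
  rw [← smul_eq_C_mul, map_smul, smul_eq_C_mul]

/-- The correction is the formula of `symDer_completeInt` with B in place of h; that formula is the
case of constant `f`, and `bernstein_mul_X` propagates it. -/
theorem symDer_bernstein (n : ℕ+) (m : ℤ) (f : SymAlg) :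
    symDer n (bernstein m f) = bernstein m (symDer n f) + C (n : ℝ) *
      (((m + n - 1 : ℤ) : SymAlg) * bernstein (m + n - 1) f -
        ∑ k ∈ Finset.range (n - 1), psum (k + 1) * bernstein (m + n - 2 - k) f) := by
  induction f using MvPolynomial.induction_on generalizing m with
  | C a =>
    simp only [bernstein_C, derivation_C, map_zero, zero_add, Derivation.leibniz,
      smul_eq_mul, symDer_completeInt, mul_left_comm _ (C a), ← Finset.mul_sum]
    ring
  | add f g hf hg =>
    simp only [map_add, mul_add, Finset.sum_add_distrib, hf, hg]
    ring
  | mul_X f i ih =>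
    have hpos : 0 < (n : ℕ) + i - 1 := by have := n.pos; have := i.pos; omega
    have hc : (((n : ℕ) + i - 1 : ℕ) : ℤ) = n + i - 1 := by omega
    have e0 : m + ((n : ℤ) + i - 1) = m + i + n - 1 := by ring
    have e1 : m + (n : ℤ) - 1 + i = m + i + n - 1 := by ring
    have e2 : ∀ k : ℕ, m + (n : ℤ) - 2 - k + i = m + i + n - 2 - k := fun k => by ring
    have h1 : bernstein m (symDer n (f * X i)) = X i * bernstein m (symDer n f) -
        bernstein (m + i) (symDer n f) + C (n : ℝ) * C (i : ℝ) *
          (psum ((n : ℕ) + i - 1) * bernstein m f - bernstein (m + i + n - 1) f) := by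
      rw [Derivation.leibniz, symDer, mkDerivation_X, symCoeff, smul_eq_mul, smul_eq_mul,
        smul_eq_C_mul, C_mul, map_add, mul_left_comm f, mul_assoc, bernstein_C_mul, bernstein_C_mul,
        bernstein_mul_psum _ _ _ hpos, mul_comm (X i), bernstein_mul_X, hc, e0]
      ring
    rw [h1, bernstein_mul_X, map_sub, Derivation.leibniz, ih, ih]
    simp only [bernstein_mul_X, e1, e2, mul_sub, Finset.sum_sub_distrib, smul_eq_mul,
      mul_left_comm _ (X i), ← Finset.mul_sum]
    rw [symDer, mkDerivation_X, symCoeff, smul_eq_C_mul, C_mul]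
    have : (C (i : ℝ) : SymAlg) = (i : ℕ) := map_natCast _ _
    rw [this]
    push_cast
    ring

theorem bernstein_mul_psum_mul_psum (n : ℤ) (f : SymAlg) (i j : ℕ) (hi : 0 < i) (hj : 0 < j) :
    bernstein n (f * (psum i * psum j)) = psum i * psum j * bernstein n f -
      psum j * bernstein (n + i) f - psum i * bernstein (n + j) f + bernstein (n + i + j) f := by
  rw [← mul_assoc, bernstein_mul_psum _ _ _ hj, bernstein_mul_psum _ _ _ hi,
    bernstein_mul_psum _ _ _ hi, add_right_comm n]
  ring

theorem drift_succ_succ (s t : ℝ) (n : ℕ+) (r : ℕ) (hn : (n : ℕ) = r + 2) :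
    drift s t n = C (n : ℝ) * (∑ k ∈ Finset.range r, psum (k + 1) * psum (r - k) +
      C s * psum (r + 1)) := by
  have : n.natPred = r + 1 := by rw [PNat.natPred, hn]; rfl
  rw [drift, this, Finset.Nat.sum_antidiagonal_eq_sum_range_succ_mk, Finset.sum_range_succ,
    Finset.sum_range_succ', smul_eq_C_mul, smul_eq_C_mul]
  simp [psum]

theorem drift_one (s t : ℝ) : drift s t 1 = C t := by
  have : PNat.natPred 1 = 0 := rfl
  simp [drift, this, psum]

/-- With the shifted parameters, the terms without a shifted Bernstein index cancel for n > 1. What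
remains combines with `symDer_bernstein` in the induction step of `lowering_bernstein`. -/
theorem bernstein_mul_drift (s t : ℝ) (m : ℤ) (n : ℕ+) (f : SymAlg) :
    drift s t n * bernstein m f - bernstein m (f * drift (s - 2) (t - s + 1) n) =
      C (n : ℝ) * (2 * ∑ k ∈ Finset.range (n - 1), psum (k + 1) * bernstein (m + n - 2 - k) f +
        C (s - n) * bernstein (m + n - 1) f) := by
  obtain ⟨r, hr⟩ : ∃ r : ℕ, (n : ℕ) = r + 1 := ⟨n.natPred, (PNat.natPred_add_one n).symm⟩
  cases r with
  | zero =>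
    obtain rfl : n = 1 := PNat.coe_injective hr
    rw [drift_one, drift_one, mul_comm f, bernstein_C_mul]
    simp
    ring
  | succ r =>
    rw [drift_succ_succ _ _ _ r hr, drift_succ_succ _ _ _ r hr, mul_left_comm f, bernstein_C_mul,
      mul_add f, map_add, mul_left_comm f, bernstein_C_mul, bernstein_mul_psum _ _ _ (Nat.succ_pos r),
      Finset.mul_sum, map_sum]
    -- The first of the two linear terms is written at the reflected index r − 1 − k, so that
    -- reflecting its sum merges it with the other and yields the factor 2.
    have h1 : ∀ k ∈ Finset.range r, bernstein m (f * (psum (k + 1) * psum (r - k))) =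
        psum (k + 1) * psum (r - k) * bernstein m f -
          psum (r - 1 - k + 1) * bernstein (m + r - ((r - 1 - k : ℕ) : ℤ)) f -
          psum (k + 1) * bernstein (m + r - k) f + bernstein (m + r + 1) f := by
      intro k hk
      have := Finset.mem_range.mp hk
      rw [bernstein_mul_psum_mul_psum _ _ _ _ (by omega) (by omega),
        show r - 1 - k + 1 = r - k by omega,
        show m + r - ((r - 1 - k : ℕ) : ℤ) = m + ((k + 1 : ℕ) : ℤ) by omega,
        show m + r - (k : ℤ) = m + ((r - k : ℕ) : ℤ) by omega,
        show m + r + 1 = m + ((k + 1 : ℕ) : ℤ) + ((r - k : ℕ) : ℤ) by omega]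
    have e : ∀ k : ℕ, m + (n : ℤ) - 2 - k = m + r - k := fun k => by omega
    have e' : m + (n : ℤ) - 1 = m + r + 1 := by omega
    have e'' : m + ((r + 1 : ℕ) : ℤ) = m + r + 1 := by push_cast; ring
    simp only [e, e']
    rw [Finset.sum_congr rfl h1, Finset.sum_add_distrib, Finset.sum_sub_distrib,
      Finset.sum_sub_distrib,
      Finset.sum_range_reflect (fun k => psum (k + 1) * bernstein (m + r - k) f),
      Finset.sum_const, Finset.card_range, ← Finset.sum_mul, hr, Nat.succ_sub_one,
      Finset.sum_range_succ, add_sub_cancel_right, e'']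
    simp only [nsmul_eq_mul, map_sub, C_add, Nat.cast_add, map_natCast, map_ofNat, Nat.cast_one]
    simp
    ring

/-- Induction on `f`: the base case is the action on h_m. Multiplication by p_n produces defects in
`drift` and `symDer`, and together they account for the change of π from m − 1 to m + n − 1. -/
theorem lowering_bernstein (s t : ℝ) (m : ℤ) (f : SymAlg) :
    lowering s t (bernstein m f) = bernstein m (lowering (s - 2) (t - s + 1) f) +
      C (contentPoly s t (m - 1)) * bernstein (m - 1) f := by
  induction f using MvPolynomial.induction_on generalizing m with
  | C a =>
    rw [bernstein_C, bernstein_C, lowering_C, map_zero, zero_add, ← smul_eq_C_mul, map_smul,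
      lowering_completeInt, smul_eq_C_mul]
    ring
  | add f g hf hg =>
    rw [map_add, map_add, map_add, map_add, map_add, hf, hg]
    ring
  | mul_X f n ih =>
    have hd := bernstein_mul_drift s t m n f
    have hs := symDer_bernstein n m f
    have e1 : m - 1 + (n : ℤ) = m + n - 1 := by ring
    have h2 : bernstein m (2 * symDer n f) = 2 * bernstein m (symDer n f) := by
      rw [two_mul, map_add, two_mul]
    -- The summand s − n comes from the drift and 2(m + n − 1) from twice the `symDer` commutator.
    have hc : C (contentPoly s t (m + n - 1)) = (C (contentPoly s t (m - 1)) +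
        C (n : ℝ) * (C (s - n) + 2 * ((m + n - 1 : ℤ) : SymAlg)) : SymAlg) := by
      have h3 : ((m + n - 1 : ℤ) : SymAlg) = C (((m + n - 1 : ℤ) : ℝ)) := (map_intCast (C : ℝ →+* SymAlg) _).symm
      have h4 : (2 : SymAlg) = C 2 := (map_ofNat (C : ℝ →+* SymAlg) 2).symm
      rw [h3, h4, ← C_mul, ← C_add, ← C_mul, ← C_add]
      congr 1
      simp only [contentPoly]
      push_cast
      ring
    rw [bernstein_mul_X, map_sub, mul_comm (X n), lowering_mul_X, lowering_mul_X, map_add, map_add,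
      h2, mul_comm (X n) (lowering _ _ f), bernstein_mul_X, bernstein_mul_X, ih, ih, e1,
      show m + (n : ℤ) - 1 = m + n - 1 by ring, hc]
    linear_combination hd + 2 * hs

/-! ## The grading -/

/-- The Euler operator `p_k ↦ k p_k`. -/
def eulerOp : Derivation ℝ SymAlg SymAlg := mkDerivation ℝ fun k => C (k : ℝ) * X k

theorem symDer_one : symDer 1 = eulerOp := by
  rw [symDer, eulerOp]
  congr 1
  ext1 k
  rw [symCoeff, smul_eq_C_mul, PNat.one_coe, Nat.add_sub_cancel_left, psum_coe]
  simp

theorem eulerOp_X (k : ℕ+) : eulerOp (X k) = C (k : ℝ) * X k := by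
  rw [eulerOp, mkDerivation_X]

/-- The case n = 1 of `symDer_bernstein`: B_m raises the degree by m. -/
theorem eulerOp_bernstein (m : ℤ) (f : SymAlg) :
    eulerOp (bernstein m f) = bernstein m (eulerOp f) + C (m : ℝ) * bernstein m f := by
  have h := symDer_bernstein 1 m f
  rw [symDer_one] at h
  simpa using h

/-! ## Jacobi–Trudi determinants -/

theorem eulerSeries_mul {R : Type*} [CommRing R] (F G : PowerSeries R) :
    eulerSeries (F * G) = F * eulerSeries G + G * eulerSeries F := by
  rw [Derivation.leibniz, smul_eq_mul, smul_eq_mul]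

theorem eulerSeries_one_sub {R : Type*} [CommRing R] (F : PowerSeries R) :
    eulerSeries (1 - F) = -eulerSeries F := by
  rw [map_sub, Derivation.map_one_eq_zero, zero_sub]

theorem eulerSeries_C_mul_X {R : Type*} [CommRing R] (a : R) :
    eulerSeries (PowerSeries.C a * PowerSeries.X) = PowerSeries.C a * PowerSeries.X := by
  rw [eulerSeries, Derivation.smul_apply, Derivation.leibniz]
  simp [mul_comm]

/-- Formally H(x) = exp(∑ p_k x^k/k), so the shift multiplies it by exp(−∑ u^k x^k/k) = 1 − ux. The
proof replaces exponentials by the equation that determines H. -/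
theorem shiftHom_complete_succ (n : ℕ) :
    shiftHom (complete (n + 1)) =
      Polynomial.C (complete (n + 1)) - Polynomial.X * Polynomial.C (complete n) := by
  let G : PowerSeries (Polynomial SymAlg) :=
    PowerSeries.mk fun n => if n = 0 then 0 else Polynomial.X ^ n
  let H : PowerSeries (Polynomial SymAlg) := PowerSeries.map Polynomial.C completeSeries
  let P : PowerSeries (Polynomial SymAlg) := PowerSeries.map Polynomial.C psumSeries
  let U : PowerSeries (Polynomial SymAlg) := PowerSeries.C Polynomial.X * PowerSeries.X
  -- The geometric series G = ux/(1 − ux), with U = ux.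
  have hG : G * (1 - U) = U := by
    ext1 n
    rw [mul_sub, mul_one, map_sub, mul_left_comm, PowerSeries.coeff_C_mul, PowerSeries.coeff_C_mul]
    cases n with
    | zero => simp [G]
    | succ n =>
      rw [PowerSeries.coeff_succ_mul_X, PowerSeries.coeff_mk, PowerSeries.coeff_mk]
      cases n with
      | zero => simp
      | succ n => simp [PowerSeries.coeff_X, pow_succ']
  have hU : eulerSeries U = U := eulerSeries_C_mul_X _
  have hH : eulerSeries H = P * H := by
    rw [← map_mul, ← eulerSeries_completeSeries]
    ext1 n
    rw [coeff_eulerSeries, PowerSeries.coeff_map, PowerSeries.coeff_map, coeff_eulerSeries]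
    simp
  have hp : ∀ n, shiftHom (psum n) = PowerSeries.coeff n (P - G) := by
    intro n
    rw [map_sub, PowerSeries.coeff_map, psumSeries, PowerSeries.coeff_mk, PowerSeries.coeff_mk]
    cases n with
    | zero => simp [psum]
    | succ n =>
      rw [psum, shiftHom, aeval_X]
      simp
  have key : PowerSeries.mk (fun n => shiftHom (complete n)) = (1 - U) * H := by
    refine eulerSeries_unique (P := P - G) (G := 0) ?_ ?_ ?_ ?_
    · rw [← hp]
      simp [psum]
    · ext1 n
      rw [coeff_eulerSeries, add_zero, PowerSeries.coeff_mul, PowerSeries.coeff_mk]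
      have h := congrArg shiftHom (complete_newton n)
      rw [map_mul, map_natCast, map_sum] at h
      rw [h]
      refine Finset.sum_congr rfl fun x _ => ?_
      rw [map_mul, hp, PowerSeries.coeff_mk]
    · rw [eulerSeries_mul, eulerSeries_one_sub, hU, hH]
      linear_combination H * hG
    · rw [PowerSeries.coeff_mk, sub_mul, one_mul, map_sub, mul_assoc, PowerSeries.coeff_C_mul,
        PowerSeries.coeff_zero_X_mul, mul_zero, sub_zero, PowerSeries.coeff_map, completeSeries,
        PowerSeries.coeff_mk, complete_zero, map_one, map_one]
  have h := congrArg (PowerSeries.coeff (n + 1)) key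
  rw [PowerSeries.coeff_mk] at h
  rw [h, sub_mul, one_mul, map_sub, mul_assoc, PowerSeries.coeff_C_mul, PowerSeries.coeff_succ_X_mul,
    PowerSeries.coeff_map, PowerSeries.coeff_map, completeSeries, PowerSeries.coeff_mk,
    PowerSeries.coeff_mk]

theorem shiftHom_completeInt (n : ℤ) :
    shiftHom (completeInt n) =
      Polynomial.C (completeInt n) - Polynomial.X * Polynomial.C (completeInt (n - 1)) := by
  rcases lt_trichotomy n 0 with h | rfl | h
  · simp [completeInt_of_neg h, completeInt_of_neg (show n - 1 < 0 by omega)]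
  · simp [completeInt_zero, completeInt_of_neg (show (-1 : ℤ) < 0 by omega)]
  · obtain ⟨m, rfl⟩ : ∃ m : ℕ, n = (m + 1 : ℕ) := ⟨(n - 1).toNat, by omega⟩
    rw [completeInt_natCast, shiftHom_complete_succ]
    push_cast
    rw [add_sub_cancel_right, completeInt_natCast]

/-- The determinant `det [h_{l_i + j}]`. -/
def jacobiTrudi (N : ℕ) (l : Fin N → ℤ) : SymAlg :=
  Matrix.det (Matrix.of fun i j : Fin N => completeInt (l i + (j : ℤ)))

theorem jacobiTrudi_zero (l : Fin 0 → ℤ) : jacobiTrudi 0 l = 1 := by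
  rw [jacobiTrudi, Matrix.det_fin_zero]

/-- A determinant with first row (1, u, u², …) is computed twice. Expansion along that row, with u^j
sent to h_{l_0+j}, gives the left side. Subtracting u times the preceding column clears the row and
turns the other entries into shifts of h, so the minor is `shiftHom` of the smaller determinant. -/
theorem jacobiTrudi_succ (N : ℕ) (l : Fin (N + 1) → ℤ) :
    jacobiTrudi (N + 1) l = bernstein (l 0) (jacobiTrudi N fun i => l i.succ + 1) := by
  let A : Matrix (Fin (N + 1)) (Fin (N + 1)) (Polynomial SymAlg) := Matrix.of fun i j =>
    Fin.cases (Polynomial.X ^ (j : ℕ))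
      (fun i' : Fin N => Polynomial.C (completeInt (l i'.succ + (j : ℤ)))) i
  let B : Matrix (Fin (N + 1)) (Fin (N + 1)) (Polynomial SymAlg) := Matrix.of fun i j =>
    Fin.cases (A i 0) (fun j' : Fin N => A i j'.succ - Polynomial.X * A i j'.castSucc) j
  have hAB : A.det = B.det := by
    refine Matrix.det_eq_of_forall_col_eq_smul_add_pred (fun _ => Polynomial.X) ?_ ?_
    · intro i
      simp [B]
    · intro i j
      simp [B]
  have hB : B.det = shiftHom (jacobiTrudi N fun i => l i.succ + 1) := by
    rw [Matrix.det_succ_row_zero, Fin.sum_univ_succ, Finset.sum_eq_zero (s := Finset.univ)]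
    · rw [jacobiTrudi, AlgHom.map_det]
      simp only [B, A, Matrix.of_apply, Fin.cases_zero, Fin.val_zero, pow_zero, one_mul, add_zero]
      congr 1
      ext1 i j
      simp only [Matrix.submatrix_apply, Matrix.of_apply, Fin.zero_succAbove, Fin.cases_succ,
        AlgHom.mapMatrix_apply, Matrix.map_apply, shiftHom_completeInt, Fin.val_succ,
        Fin.val_castSucc]
      rw [show l i.succ + ((j : ℕ) + 1 : ℕ) = l i.succ + 1 + (j : ℕ) by push_cast; ring,
        show l i.succ + 1 + (j : ℕ) - 1 = l i.succ + (j : ℕ) by ring]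
    · intro j _
      simp [B, A, pow_succ']
  have hA : evalComplete (l 0) A.det = jacobiTrudi (N + 1) l := by
    rw [Matrix.det_succ_row_zero, jacobiTrudi, Matrix.det_succ_row_zero, map_sum]
    refine Finset.sum_congr rfl fun j _ => ?_
    have hm : (A.submatrix Fin.succ j.succAbove).det = Polynomial.C
        ((Matrix.of fun i j : Fin (N + 1) => completeInt (l i + (j : ℤ))).submatrix Fin.succ
          j.succAbove).det := by
      rw [RingHom.map_det]
      congr 1
    rw [hm]
    have hs : (-1 : Polynomial SymAlg) ^ (j : ℕ) * A 0 j = Polynomial.monomial j ((-1) ^ (j : ℕ)) := by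
      rw [← Polynomial.C_mul_X_pow_eq_monomial]
      simp [A]
    rw [hs, Polynomial.monomial_mul_C, evalComplete_monomial, Matrix.of_apply]
    ring
  rw [bernstein_apply, ← hB, ← hAB, hA]

theorem update_zero_succ {N : ℕ} (l : Fin (N + 1) → ℤ) (a : ℤ) :
    (fun i : Fin N => Function.update l 0 a i.succ + 1) = fun i => l i.succ + 1 := by
  ext i
  rw [Function.update_of_ne (Fin.succ_ne_zero i)]

theorem update_succ_succ {N : ℕ} (l : Fin (N + 1) → ℤ) (k : Fin N) (a : ℤ) :
    (fun i : Fin N => Function.update l k.succ a i.succ + 1) =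
      Function.update (fun i => l i.succ + 1) k (a + 1) := by
  ext i
  by_cases h : i = k
  · simp [h]
  · rw [Function.update_of_ne h, Function.update_of_ne fun e => h (Fin.succ_injective _ e)]

/-- The action of the lowering operator on Jacobi–Trudi determinants. -/
theorem lowering_jacobiTrudi (s t : ℝ) (N : ℕ) (l : Fin N → ℤ) :
    lowering s t (jacobiTrudi N l) =
      ∑ i, C (contentPoly s t (l i - 1)) * jacobiTrudi N (Function.update l i (l i - 1)) := by
  induction N generalizing s t with
  | zero => rw [jacobiTrudi_zero, ← C_1, lowering_C, Fin.sum_univ_zero]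
  | succ N ih =>
    rw [jacobiTrudi_succ, lowering_bernstein, ih, Fin.sum_univ_succ, add_comm, map_sum,
      jacobiTrudi_succ N (Function.update l 0 _), Function.update_self, update_zero_succ]
    congr 1
    refine Finset.sum_congr rfl fun i _ => ?_
    rw [bernstein_C_mul, jacobiTrudi_succ, update_succ_succ,
      Function.update_of_ne (Fin.succ_ne_zero i).symm, sub_add_cancel, add_sub_cancel_right]
    -- The parameter change compensates the index shift: π_{s−2,t−s+1}(w) = π_{s,t}(w − 1).
    congr 2
    simp only [contentPoly]
    push_cast
    ring

theorem eulerOp_jacobiTrudi (N : ℕ) (l : Fin N → ℤ) :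
    eulerOp (jacobiTrudi N l) = C (∑ i, ((l i : ℝ) + (i : ℕ))) * jacobiTrudi N l := by
  induction N with
  | zero => simp [jacobiTrudi_zero]
  | succ N ih =>
    rw [jacobiTrudi_succ, eulerOp_bernstein, ih, bernstein_C_mul, Fin.sum_univ_succ, C_add,
      add_mul, add_comm]
    congr 2
    · simp
    · congr 2
      ext i
      push_cast
      simp only [Fin.val_succ]
      push_cast
      ring

/-! ## Jacobi–Trudi determinants span -/

/-- The span of all Jacobi–Trudi determinants. -/
def jacobiTrudiSpan : Submodule ℝ SymAlg :=
  Submodule.span ℝ {f | ∃ (N : ℕ) (l : Fin N → ℤ), f = jacobiTrudi N l}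

theorem jacobiTrudi_mem (N : ℕ) (l : Fin N → ℤ) : jacobiTrudi N l ∈ jacobiTrudiSpan :=
  Submodule.subset_span ⟨N, l, rfl⟩

theorem bernstein_jacobiTrudi (n : ℤ) (N : ℕ) (l : Fin N → ℤ) :
    bernstein n (jacobiTrudi N l) =
      jacobiTrudi (N + 1) (Fin.cons n fun i => l i - 1 : Fin (N + 1) → ℤ) := by
  rw [jacobiTrudi_succ]
  simp

theorem bernstein_mem (n : ℤ) {f : SymAlg} (hf : f ∈ jacobiTrudiSpan) :
    bernstein n f ∈ jacobiTrudiSpan := by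
  induction hf using Submodule.span_induction with
  | mem f hf =>
    obtain ⟨N, l, rfl⟩ := hf
    rw [bernstein_jacobiTrudi]
    exact jacobiTrudi_mem _ _
  | zero => simp
  | add f g _ _ hf hg =>
    rw [map_add]
    exact add_mem hf hg
  | smul a f _ hf =>
    rw [map_smul]
    exact Submodule.smul_mem _ _ hf

theorem one_mem_jacobiTrudiSpan : (1 : SymAlg) ∈ jacobiTrudiSpan := by
  rw [← jacobiTrudi_zero Fin.elim0]
  exact jacobiTrudi_mem _ _

/-- Newton's identity is solved for its last power sum. Each other product is p_k h_j = B_j(p_k) +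
h_{j+k}, where p_k has smaller index and is covered by induction. -/
theorem psum_mem (n : ℕ) : psum n ∈ jacobiTrudiSpan := by
  induction n using Nat.strong_induction_on with
  | _ n ih =>
  have hh : ∀ m : ℤ, bernstein m 1 = completeInt m := fun m => by
    rw [← C_1, bernstein_C, C_1, one_mul]
  have hm : ∀ m : ℤ, completeInt m ∈ jacobiTrudiSpan := fun m => by
    rw [← hh]
    exact bernstein_mem _ one_mem_jacobiTrudiSpan
  cases n with
  | zero => exact zero_mem _
  | succ n =>
    have h := completeInt_newton (n + 1 : ℕ) (n + 1) le_rfl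
    rw [Finset.sum_range_succ, show ((n + 1 : ℕ) : ℤ) - 1 - n = 0 by push_cast; ring,
      completeInt_zero, mul_one] at h
    rw [← sub_eq_iff_eq_add'.mpr h]
    refine sub_mem ?_ (sum_mem fun k hk => ?_)
    · rw [Int.cast_natCast, ← nsmul_eq_mul]
      exact nsmul_mem (hm _) _
    · have e := bernstein_mul_psum (((n + 1 : ℕ) : ℤ) - 1 - k) 1 (k + 1) k.succ_pos
      rw [one_mul, hh, hh, eq_sub_iff_add_eq] at e
      rw [← e]
      exact add_mem (bernstein_mem _ (ih _ (by have := Finset.mem_range.mp hk; omega))) (hm _)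

/-- From p_k B_n f = B_n(f p_k) + B_{n+k} f, by induction on the size of the determinant; hence the
span is closed under multiplication by every generator. -/
theorem mul_X_mem (k : ℕ+) {f : SymAlg} (hf : f ∈ jacobiTrudiSpan) :
    f * X k ∈ jacobiTrudiSpan := by
  induction hf using Submodule.span_induction with
  | mem f hf =>
    obtain ⟨N, l, rfl⟩ := hf
    induction N with
    | zero =>
      rw [jacobiTrudi_zero, one_mul, ← psum_coe]
      exact psum_mem _
    | succ N ih =>
      have e := bernstein_mul_X (l 0) (jacobiTrudi N fun i => l i.succ + 1) k
      rw [eq_sub_iff_add_eq] at e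
      rw [jacobiTrudi_succ, mul_comm, ← e]
      exact add_mem (bernstein_mem _ (ih _)) (bernstein_mem _ (jacobiTrudi_mem _ _))
  | zero => simp
  | add f g _ _ hf hg =>
    rw [add_mul]
    exact add_mem hf hg
  | smul a f _ hf =>
    rw [smul_mul_assoc]
    exact Submodule.smul_mem _ _ hf

theorem jacobiTrudiSpan_eq_top : jacobiTrudiSpan = ⊤ := by
  rw [eq_top_iff]
  rintro f -
  induction f using MvPolynomial.induction_on with
  | C a =>
    rw [← mul_one (C a), ← smul_eq_C_mul]
    exact Submodule.smul_mem _ _ one_mem_jacobiTrudiSpan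
  | add f g hf hg => exact add_mem hf hg
  | mul_X f k hf => exact mul_X_mem k hf

/-! ## Schur functions as Jacobi–Trudi determinants -/

theorem schur_def (μ : YoungDiagram) :
    schur μ = jacobiTrudi (μ.colLen 0) fun i => (μ.rowLen i : ℤ) - (i : ℕ) := rfl

theorem rowLen_eq_of_mem_iff {μ : YoungDiagram} {i n : ℕ} (h : ∀ j, (i, j) ∈ μ ↔ j < n) :
    μ.rowLen i = n :=
  eq_of_forall_lt_iff fun j => by rw [← YoungDiagram.mem_iff_lt_rowLen, h]

theorem rowLen_pos_iff {μ : YoungDiagram} {i : ℕ} : 0 < μ.rowLen i ↔ i < μ.colLen 0 := by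
  rw [← YoungDiagram.mem_iff_lt_rowLen, YoungDiagram.mem_iff_lt_colLen]

theorem colLen_zero_le {μ : YoungDiagram} {n : ℕ} (h : (n, 0) ∉ μ) : μ.colLen 0 ≤ n := by
  rwa [YoungDiagram.mem_iff_lt_colLen, not_lt] at h

theorem jacobiTrudi_eq_zero_of_last_lt {N : ℕ} (l : Fin (N + 1) → ℤ)
    (h : l (Fin.last N) < -(N : ℤ)) : jacobiTrudi (N + 1) l = 0 := by
  refine Matrix.det_eq_zero_of_row_eq_zero (Fin.last N) fun j => ?_
  rw [Matrix.of_apply, completeInt_of_neg]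
  have := j.is_le
  omega

/-- The last row is (0, …, 0, 1), the row contributed by an empty row of a diagram. -/
theorem jacobiTrudi_eq_of_last {N : ℕ} (l : Fin (N + 1) → ℤ) (h : l (Fin.last N) = -(N : ℤ)) :
    jacobiTrudi (N + 1) l = jacobiTrudi N fun i => l i.castSucc := by
  rw [jacobiTrudi, Matrix.det_succ_row _ (Fin.last N), Fin.sum_univ_castSucc,
    Finset.sum_eq_zero (s := Finset.univ), zero_add]
  · simp only [Matrix.of_apply, h, Fin.val_last, neg_add_cancel, completeInt_zero,
      Fin.succAbove_last, mul_one]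
    rw [← two_mul, pow_mul, neg_one_sq, one_pow, one_mul]
    rfl
  · intro j _
    rw [Matrix.of_apply, completeInt_of_neg, mul_zero, zero_mul]
    have := j.is_lt
    simp only [h, Fin.val_castSucc]
    omega

theorem jacobiTrudi_eq_zero_of_eq {N : ℕ} (l : Fin N → ℤ) {i j : Fin N} (hij : i ≠ j)
    (h : l i = l j) : jacobiTrudi N l = 0 :=
  Matrix.det_zero_of_row_eq hij (by ext1 k; rw [Matrix.of_apply, Matrix.of_apply, h])

theorem schur_eq_jacobiTrudi (μ : YoungDiagram) {N : ℕ} (hN : μ.colLen 0 ≤ N) :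
    schur μ = jacobiTrudi N fun i => (μ.rowLen i : ℤ) - (i : ℕ) := by
  induction N, hN using Nat.le_induction with
  | base => rfl
  | succ N hN ih =>
    rw [jacobiTrudi_eq_of_last, ih]
    · rfl
    · have : μ.rowLen N = 0 := by
        have := (rowLen_pos_iff (μ := μ) (i := N)).not
        omega
      simp [this]

/-! ### Straightening Jacobi–Trudi determinants into Schur functions -/

/-- The numbers l_i + i decrease weakly. If all are nonnegative they are the row lengths of a
diagram; otherwise the last is negative and the last matrix row vanishes. -/
theorem jacobiTrudi_mem_span_schur_of_strictAnti {N : ℕ} (l : Fin N → ℤ) (hl : StrictAnti l) :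
    jacobiTrudi N l ∈ Submodule.span ℝ (Set.range schur) := by
  by_cases hneg : ∃ i : Fin N, l i + (i : ℕ) < 0
  · cases N with
    | zero => exact hneg.choose.elim0
    | succ N =>
      rw [jacobiTrudi_eq_zero_of_last_lt]
      · exact zero_mem _
      · obtain ⟨i, hi⟩ := hneg
        have key : ∀ k : ℕ, ∀ hk : k < N + 1, (i : ℕ) ≤ k → l ⟨k, hk⟩ + k < 0 := by
          intro k hk hik
          induction k, hik using Nat.le_induction with
          | base => exact hi
          | succ k _ ih =>
            have h1 := ih (by omega)
            have h2 := hl (show (⟨k, by omega⟩ : Fin (N + 1)) < ⟨k + 1, hk⟩ from Nat.lt_succ_self k)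
            push_cast
            omega
        have := key N (Nat.lt_succ_self N) i.is_le
        change l ⟨N, _⟩ < _
        omega
  · push Not at hneg
    let w : List ℕ := List.ofFn fun i : Fin N => (l i + (i : ℕ)).toNat
    have hanti : Antitone fun i : Fin N => (l i + (i : ℕ)).toNat := by
      cases N with
      | zero => exact fun i => i.elim0
      | succ N =>
        rw [Fin.antitone_iff_succ_le]
        intro i
        have h2 := hl (Fin.castSucc_lt_succ (i := i))
        simp only [Fin.val_succ, Fin.val_castSucc]
        omega
    have hw : w.SortedGE := List.sortedGE_ofFn_iff.mpr hanti
    have hlen : w.length = N := List.length_ofFn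
    have hrow : ∀ i : Fin N, ((YoungDiagram.ofRowLens w hw).rowLen i : ℤ) = l i + (i : ℕ) := by
      intro i
      have h := YoungDiagram.rowLen_ofRowLens (hw := hw) (i.cast hlen.symm)
      have h' : w[(i : ℕ)]'(by rw [hlen]; exact i.is_lt) = (l i + (i : ℕ)).toNat := by
        simp [w]
      have := hneg i
      simp only [Fin.val_cast, Fin.getElem_fin] at h
      rw [h, h']
      omega
    have hcol : (YoungDiagram.ofRowLens w hw).colLen 0 ≤ N := by
      refine colLen_zero_le fun h => ?_
      obtain ⟨h', -⟩ := YoungDiagram.mem_ofRowLens.mp h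
      rw [hlen] at h'
      exact lt_irrefl _ h'
    refine Submodule.subset_span ⟨YoungDiagram.ofRowLens w hw, ?_⟩
    rw [schur_eq_jacobiTrudi _ hcol]
    congr 1
    ext i
    rw [hrow, add_sub_cancel_right]

/-- Sorting the rows changes only the sign, and a repeated row gives zero. -/
theorem jacobiTrudi_mem_span_schur (N : ℕ) (l : Fin N → ℤ) :
    jacobiTrudi N l ∈ Submodule.span ℝ (Set.range schur) := by
  by_cases hinj : Function.Injective l
  · let σ := Tuple.sort fun i => -l i
    have hanti : Antitone (l ∘ σ) := fun i j hij =>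
      neg_le_neg_iff.mp (Tuple.monotone_sort (fun i => -l i) hij)
    have hmem := jacobiTrudi_mem_span_schur_of_strictAnti (l ∘ σ)
      (hanti.strictAnti_of_injective (hinj.comp σ.injective))
    have e : jacobiTrudi N (l ∘ σ) = ((Equiv.Perm.sign σ : ℤ) : SymAlg) * jacobiTrudi N l := by
      rw [jacobiTrudi, jacobiTrudi, ← Matrix.det_permute]
      rfl
    rcases Int.units_eq_one_or (Equiv.Perm.sign σ) with h | h
    · rw [h] at e
      simpa [e] using hmem
    · rw [h] at e
      simpa [e] using hmem
  · obtain ⟨i, j, h, hij⟩ := Function.not_injective_iff.mp hinj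
    rw [jacobiTrudi_eq_zero_of_eq l hij h]
    exact zero_mem _

theorem span_schur_eq_top : Submodule.span ℝ (Set.range schur) = ⊤ := by
  rw [eq_top_iff, ← jacobiTrudiSpan_eq_top, jacobiTrudiSpan, Submodule.span_le]
  rintro _ ⟨N, l, rfl⟩
  exact jacobiTrudi_mem_span_schur N l

/-! ## The action on Schur functions -/

theorem card_eq_sum_rowLen (μ : YoungDiagram) :
    μ.card = ∑ i : Fin (μ.colLen 0), μ.rowLen i := by
  rw [YoungDiagram.card, Finset.card_eq_sum_card_fiberwise (f := Prod.fst)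
    (t := Finset.range (μ.colLen 0)), Finset.sum_range]
  · refine Finset.sum_congr rfl fun i _ => ?_
    rw [YoungDiagram.rowLen_eq_card]
    rfl
  · intro c hc
    have h : (c.1, 0) ∈ μ := μ.up_left_mem le_rfl (Nat.zero_le c.2) ((μ.mem_cells c).mp hc)
    simpa using YoungDiagram.mem_iff_lt_colLen.mp h

theorem eulerOp_schur (μ : YoungDiagram) : eulerOp (schur μ) = C (μ.card : ℝ) * schur μ := by
  rw [schur_def, eulerOp_jacobiTrudi, card_eq_sum_rowLen]
  congr 2
  push_cast
  refine Finset.sum_congr rfl fun i _ => ?_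
  ring

/-! ### Removable corners -/

/-- The diagram obtained by removing the last box of a row that is longer than the next one. -/
def eraseCorner (μ : YoungDiagram) (i : ℕ) (h : μ.rowLen (i + 1) < μ.rowLen i) : YoungDiagram where
  cells := μ.cells.erase (i, μ.rowLen i - 1)
  isLowerSet := by
    rintro ⟨a, b⟩ ⟨a', b'⟩ ⟨ha, hb⟩ hmem
    simp only [Finset.coe_erase, Set.mem_sdiff, Finset.mem_coe, YoungDiagram.mem_cells,
      Set.mem_singleton_iff] at hmem ⊢
    refine ⟨μ.up_left_mem ha hb hmem.1, fun e => hmem.2 ?_⟩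
    obtain ⟨rfl, rfl⟩ := Prod.mk.inj e
    have hb' : μ.rowLen a' - 1 ≤ b := hb
    have ha' : a' ≤ a := ha
    have h1 := YoungDiagram.mem_iff_lt_rowLen.mp hmem.1
    rcases ha'.eq_or_lt with rfl | hlt
    · exact Prod.ext rfl (by change b = μ.rowLen a' - 1; omega)
    · have := μ.rowLen_anti (a' + 1) a hlt
      omega

theorem mem_eraseCorner {μ : YoungDiagram} {i : ℕ} {h : μ.rowLen (i + 1) < μ.rowLen i}
    {c : ℕ × ℕ} : c ∈ eraseCorner μ i h ↔ c ≠ (i, μ.rowLen i - 1) ∧ c ∈ μ := by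
  rw [← YoungDiagram.mem_cells, eraseCorner, Finset.mem_erase, YoungDiagram.mem_cells]

theorem corner_mem {μ : YoungDiagram} {i : ℕ} (h : μ.rowLen (i + 1) < μ.rowLen i) :
    (i, μ.rowLen i - 1) ∈ μ := YoungDiagram.mem_iff_lt_rowLen.mpr (by omega)

theorem mem_removeBox {μ ν : YoungDiagram} : ν ∈ removeBox μ ↔ ν ≤ μ ∧ μ.card = ν.card + 1 := by
  rw [removeBox, Set.Finite.mem_toFinset]
  rfl

theorem eraseCorner_mem_removeBox {μ : YoungDiagram} {i : ℕ}
    (h : μ.rowLen (i + 1) < μ.rowLen i) : eraseCorner μ i h ∈ removeBox μ := by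
  rw [mem_removeBox]
  refine ⟨fun c hc => (mem_eraseCorner.mp hc).2, ?_⟩
  exact (Finset.card_erase_add_one ((μ.mem_cells _).mpr (corner_mem h))).symm

theorem exists_eraseCorner_eq {μ ν : YoungDiagram} (hν : ν ∈ removeBox μ) :
    ∃ (i : ℕ) (h : μ.rowLen (i + 1) < μ.rowLen i), eraseCorner μ i h = ν := by
  obtain ⟨hle, hcard⟩ := mem_removeBox.mp hν
  have hsub : ν.cells ⊆ μ.cells := YoungDiagram.cells_subset_iff.mpr hle
  have h1 : (μ.cells \ ν.cells).card = 1 := by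
    rw [Finset.card_sdiff_of_subset hsub]
    change μ.card - ν.card = 1
    omega
  obtain ⟨⟨i, j⟩, hc⟩ := Finset.card_eq_one.mp h1
  have hiff : ∀ c, c ∈ ν ↔ c ∈ μ ∧ c ≠ (i, j) := by
    intro c
    have := congrArg (c ∈ ·) hc
    simp only [Finset.mem_sdiff, YoungDiagram.mem_cells, Finset.mem_singleton, eq_iff_iff] at this
    have := @hle c
    tauto
  have hmem : (i, j) ∈ μ := by
    have : (i, j) ∈ μ.cells \ ν.cells := by rw [hc]; exact Finset.mem_singleton_self _
    exact (μ.mem_cells _).mp (Finset.mem_sdiff.mp this).1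
  have hnot : (i, j) ∉ ν := fun h => ((hiff _).mp h).2 rfl
  have hj := YoungDiagram.mem_iff_lt_rowLen.mp hmem
  -- A box to the right of (i, j) would remain in `ν` and force (i, j) into `ν`; the same argument
  -- applies below.
  have hj' : μ.rowLen i = j + 1 := by
    by_contra hne
    refine hnot (ν.up_left_mem le_rfl (Nat.le_succ j) ((hiff (i, j + 1)).mpr ⟨?_, by simp⟩))
    exact YoungDiagram.mem_iff_lt_rowLen.mpr (by omega)
  have hi : μ.rowLen (i + 1) < μ.rowLen i := by
    by_contra hge
    refine hnot (ν.up_left_mem (Nat.le_succ i) le_rfl ((hiff (i + 1, j)).mpr ⟨?_, by simp⟩))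
    exact YoungDiagram.mem_iff_lt_rowLen.mpr (by omega)
  refine ⟨i, hi, ?_⟩
  ext c
  rw [YoungDiagram.mem_cells, YoungDiagram.mem_cells, mem_eraseCorner, hiff, hj',
    Nat.add_sub_cancel, and_comm]

theorem contentProd_eraseCorner (z : ℂ) {μ : YoungDiagram} {i : ℕ}
    (h : μ.rowLen (i + 1) < μ.rowLen i) :
    contentProd z μ (eraseCorner μ i h) = z + (((μ.rowLen i : ℝ) - i - 1 : ℝ) : ℂ) := by
  have : μ.cells \ (eraseCorner μ i h).cells = {(i, μ.rowLen i - 1)} :=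
    Finset.sdiff_erase_self ((μ.mem_cells _).mpr (corner_mem h))
  rw [contentProd, this, Finset.prod_singleton]
  have hpos : 1 ≤ μ.rowLen i := by omega
  push_cast [Nat.cast_sub hpos]
  ring

theorem rowLen_eraseCorner {μ : YoungDiagram} {i : ℕ} (h : μ.rowLen (i + 1) < μ.rowLen i) (a : ℕ) :
    (eraseCorner μ i h).rowLen a = if a = i then μ.rowLen i - 1 else μ.rowLen a := by
  refine rowLen_eq_of_mem_iff fun j => ?_
  rw [mem_eraseCorner, YoungDiagram.mem_iff_lt_rowLen, ne_eq, Prod.mk.injEq]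
  split_ifs with ha
  · subst ha
    omega
  · tauto

theorem schur_eraseCorner {μ : YoungDiagram} (i : Fin (μ.colLen 0))
    (h : μ.rowLen ((i : ℕ) + 1) < μ.rowLen i) :
    schur (eraseCorner μ i h) = jacobiTrudi (μ.colLen 0)
      (Function.update (fun i => (μ.rowLen i : ℤ) - (i : ℕ)) i
        ((μ.rowLen i : ℤ) - (i : ℕ) - 1)) := by
  rw [schur_eq_jacobiTrudi (N := μ.colLen 0)]
  · congr 1
    ext k
    rw [rowLen_eraseCorner, Function.update_apply]
    by_cases hk : k = i
    · subst hk
      simp only [if_true]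
      omega
    · rw [if_neg hk, if_neg fun e => hk (Fin.ext e)]
  · refine colLen_zero_le fun hm => ?_
    exact lt_irrefl _ (YoungDiagram.mem_iff_lt_colLen.mp (mem_eraseCorner.mp hm).2)

/-- When rows i and i + 1 have equal length, lowering the index of row i makes the two matrix rows
equal. -/
theorem jacobiTrudi_update_eq_zero {μ : YoungDiagram} (i : Fin (μ.colLen 0))
    (h : ¬ μ.rowLen ((i : ℕ) + 1) < μ.rowLen i) :
    jacobiTrudi (μ.colLen 0) (Function.update (fun i => (μ.rowLen i : ℤ) - (i : ℕ)) i
        ((μ.rowLen i : ℤ) - (i : ℕ) - 1)) = 0 := by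
  have heq : μ.rowLen ((i : ℕ) + 1) = μ.rowLen i :=
    le_antisymm (μ.rowLen_anti _ _ (Nat.le_succ _)) (not_lt.mp h)
  have hlt : (i : ℕ) + 1 < μ.colLen 0 := by
    rw [← rowLen_pos_iff, heq, rowLen_pos_iff]
    exact i.is_lt
  have hne : (⟨(i : ℕ) + 1, hlt⟩ : Fin (μ.colLen 0)) ≠ i := fun e => by
    have := congrArg Fin.val e
    simp at this
  refine jacobiTrudi_eq_zero_of_eq _ hne.symm ?_
  rw [Function.update_self, Function.update_of_ne hne]
  simp only [heq]
  push_cast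
  ring

theorem contentProd_mul_re (z z' : ℂ) (w : ℝ) :
    ((z + w) * (z' + w)).re = w ^ 2 + (z + z').re * w + (z * z').re := by
  simp
  ring

/-- Row i contributes weight π(l_i − 1), and l_i − 1 = μ_i − i − 1 is the content of its last box.
Rows not ending in a corner contribute zero, and the others correspond to the removable boxes. -/
theorem lowering_schur (z z' : ℂ) (μ : YoungDiagram) :
    lowering (z + z').re (z * z').re (schur μ) =
      ∑ ν ∈ removeBox μ, (contentProd z μ ν * contentProd z' μ ν).re • schur ν := by
  rw [schur_def, lowering_jacobiTrudi, ← Finset.sum_filter_add_sum_filter_not Finset.univ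
    fun i : Fin (μ.colLen 0) => μ.rowLen ((i : ℕ) + 1) < μ.rowLen i]
  rw [Finset.sum_eq_zero (s := Finset.univ.filter fun i : Fin (μ.colLen 0) =>
    ¬ μ.rowLen ((i : ℕ) + 1) < μ.rowLen i), add_zero]
  · refine Finset.sum_bij (fun i hi => eraseCorner μ i (Finset.mem_filter.mp hi).2) ?_ ?_ ?_ ?_
    · intro i hi
      exact eraseCorner_mem_removeBox _
    · intro i hi k hk e
      have hi' := (Finset.mem_filter.mp hi).2
      by_contra hne
      have hm : ((i : ℕ), μ.rowLen i - 1) ∈ eraseCorner μ k (Finset.mem_filter.mp hk).2 :=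
        mem_eraseCorner.mpr ⟨fun e => hne (Fin.ext (Prod.mk.inj e).1), corner_mem hi'⟩
      rw [← e] at hm
      exact (mem_eraseCorner.mp hm).1 rfl
    · intro ν hν
      obtain ⟨i, h, rfl⟩ := exists_eraseCorner_eq hν
      exact ⟨⟨i, rowLen_pos_iff.mp (by omega)⟩, Finset.mem_filter.mpr ⟨Finset.mem_univ _, h⟩, rfl⟩
    · intro i hi
      rw [schur_eraseCorner, contentProd_eraseCorner, contentProd_eraseCorner, contentProd_mul_re,
        smul_eq_C_mul, contentPoly]
      push_cast
      rfl
  · intro i hi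
    rw [jacobiTrudi_update_eq_zero i (Finset.mem_filter.mp hi).2, mul_zero]

/-! ## The operator in moment coordinates -/

theorem finsum_smul_mul_pderiv (c : ℕ+ → ℝ) (g : ℕ+ → MomentAlg) (F : MomentAlg) :
    ∑ᶠ i : ℕ+, c i • (g i * pderiv i F) = mkDerivation ℝ (fun i => C (c i) * g i) F := by
  rw [mkDerivation_eq_sum _ F F.vars subset_rfl, finsum_eq_sum_of_support_subset (s := F.vars)]
  · simp only [smul_eq_C_mul, mul_assoc]
  · intro i hi
    by_contra h
    exact hi (by simp [pderiv_eq_zero_of_notMem_vars h])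

/-- The coefficient of `∂/∂q_n` in `∑ (i + j + 3) q_i q_j ∂/∂q_{i+j+2}`. -/
def quadCoeff (n : ℕ+) : MomentAlg :=
  -- Truncated subtraction makes 1 − 2 = 0, which would otherwise add a spurious q_0² term.
  if (n : ℕ) = 1 then 0 else
    C ((n : ℝ) + 1) * ∑ x ∈ Finset.HasAntidiagonal.antidiagonal ((n : ℕ) - 2), q x.1 * q x.2

theorem finsum_quadratic (F : MomentAlg) :
    ∑ᶠ ij : ℕ × ℕ, ((ij.1 : ℝ) + (ij.2 : ℝ) + 3) •
        (q ij.1 * q ij.2 * pderiv (ij.1 + ij.2 + 1).succPNat F) =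
      mkDerivation ℝ quadCoeff F := by
  obtain ⟨M, hM⟩ : ∃ M : ℕ, ∀ k ∈ F.vars, (k : ℕ) ≤ M :=
    ⟨F.vars.sup fun k => (k : ℕ), fun k hk => Finset.le_sup (f := fun k : ℕ+ => (k : ℕ)) hk⟩
  let S : Finset (ℕ × ℕ) := Finset.range M ×ˢ Finset.range M
  let g : ℕ × ℕ → MomentAlg := fun ij => C ((ij.1 : ℝ) + (ij.2 : ℝ) + 3) * (q ij.1 * q ij.2)
  rw [finsum_eq_sum_of_support_subset (s := S)]
  · have h := derivation_eq_of_forall_mem_vars (D₁ := mkDerivation ℝ quadCoeff)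
      (D₂ := ∑ ij ∈ S, g ij • (pderiv (ij.1 + ij.2 + 1).succPNat :
        Derivation ℝ MomentAlg MomentAlg)) (f := F) (by
        intro k hk
        have hkM := hM k hk
        rw [mkDerivation_X, derivation_sum_apply]
        have h1 : ∀ ij : ℕ × ℕ, (g ij • (pderiv (ij.1 + ij.2 + 1).succPNat :
            Derivation ℝ MomentAlg MomentAlg)) (X k) =
              if ij.1 + ij.2 + 2 = (k : ℕ) then g ij else 0 := by
          intro ij
          have : (ij.1 + ij.2 + 2 = (k : ℕ)) ↔ k = (ij.1 + ij.2 + 1).succPNat := by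
            rw [← PNat.coe_inj, Nat.succPNat_coe]
            omega
          rw [Derivation.smul_apply, pderiv_X, Pi.single_apply, smul_eq_mul]
          simp only [this, mul_ite, mul_one, mul_zero]
        simp only [h1]
        rw [← Finset.sum_filter, quadCoeff]
        split_ifs with hk1
        · rw [Finset.filter_false_of_mem, Finset.sum_empty]
          intro ij _
          omega
        · have hk2 : 2 ≤ (k : ℕ) := by have := k.pos; omega
          rw [Finset.mul_sum]
          refine Finset.sum_congr ?_ fun x hx => ?_
          · ext x
            simp only [S, Finset.mem_filter, Finset.mem_product, Finset.mem_range,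
              Finset.HasAntidiagonal.mem_antidiagonal]
            omega
          · have hx' := (Finset.mem_filter.mp hx).2
            have : (k : ℝ) = x.1 + x.2 + 2 := by
              have : (k : ℕ) = x.1 + x.2 + 2 := by omega
              exact_mod_cast this
            simp only [g]
            congr 2
            rw [this]
            ring)
    rw [h, derivation_sum_apply]
    simp only [g, smul_eq_C_mul, Derivation.smul_apply, smul_eq_mul, mul_assoc]
  · rintro ⟨i, j⟩ hij
    have hmem : (i + j + 1).succPNat ∈ F.vars := by
      by_contra h
      exact hij (by simp [pderiv_eq_zero_of_notMem_vars h])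
    have := hM _ hmem
    simp only [Nat.succPNat_coe] at this
    simp only [S, Finset.coe_product, Finset.coe_range, Set.mem_prod, Set.mem_Iio]
    omega

/-- The coefficients of the second order part of the operator in moment coordinates. -/
def momentCoeff (i j : ℕ+) : MomentAlg :=
  C (((i : ℝ) + 1) * ((j : ℝ) + 1)) * (q (i + j) - q i * q j)

theorem momentCoeff_comm (i j : ℕ+) : momentCoeff i j = momentCoeff j i := by
  rw [momentCoeff, momentCoeff, add_comm (i : ℕ), mul_comm ((i : ℝ) + 1), mul_comm (q i)]

/-- The coefficients of the first order part of the operator in moment coordinates. -/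
def momentDrift (s t : ℝ) (n : ℕ+) : MomentAlg :=
  -(C t * (C ((n : ℝ) + 1) * q n)) + C s * (C ((n : ℝ) + 1) * q ((n : ℕ) - 1)) + quadCoeff n -
    C (((n : ℝ) + 1) * n) * q n

theorem diffOp_eq (z z' : ℂ) (F : MomentAlg) :
    diffOp z z' F = secondOrder momentCoeff F +
      mkDerivation ℝ (momentDrift (z + z').re (z * z').re) F := by
  have h1 : ∑ᶠ ij : ℕ+ × ℕ+, (((ij.1 : ℝ) + 1) * ((ij.2 : ℝ) + 1)) •
      ((q (ij.1 + ij.2) - q ij.1 * q ij.2) * pderiv ij.1 (pderiv ij.2 F)) =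
        secondOrder momentCoeff F := by
    rw [secondOrder_apply]
    simp only [momentCoeff, smul_eq_C_mul, mul_assoc]
  have h2 : mkDerivation ℝ (momentDrift (z + z').re (z * z').re) F =
      -(C (z * z').re * mkDerivation ℝ (fun n : ℕ+ => C ((n : ℝ) + 1) * q n) F) +
      C (z + z').re * mkDerivation ℝ (fun n : ℕ+ => C ((n : ℝ) + 1) * q ((n : ℕ) - 1)) F +
      mkDerivation ℝ quadCoeff F -
      mkDerivation ℝ (fun n : ℕ+ => C (((n : ℝ) + 1) * n) * q n) F := by
    simp only [mkDerivation_eq_sum _ F F.vars subset_rfl, Finset.mul_sum,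
      ← Finset.sum_neg_distrib, ← Finset.sum_add_distrib, ← Finset.sum_sub_distrib]
    refine Finset.sum_congr rfl fun i _ => ?_
    rw [momentDrift]
    ring
  rw [diffOp, h1, h2, finsum_quadratic, finsum_smul_mul_pderiv, finsum_smul_mul_pderiv,
    finsum_smul_mul_pderiv, smul_eq_C_mul, smul_eq_C_mul]
  ring

/-- The operator in moment coordinates as a linear map. -/
def diffOpLinear (z z' : ℂ) : MomentAlg →ₗ[ℝ] MomentAlg :=
  secondOrder momentCoeff + (mkDerivation ℝ (momentDrift (z + z').re (z * z').re)).toLinearMap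

theorem diffOpLinear_apply (z z' : ℂ) (F : MomentAlg) : diffOpLinear z z' F = diffOp z z' F :=
  (diffOp_eq z z' F).symm

theorem diffOp_mul_X (z z' : ℂ) (F : MomentAlg) (n : ℕ+) :
    diffOp z z' (F * X n) = X n * diffOp z z' F +
      F * momentDrift (z + z').re (z * z').re n + 2 * mkDerivation ℝ (momentCoeff n) F := by
  rw [diffOp_eq, diffOp_eq, secondOrder_mul_X _ momentCoeff_comm, Derivation.leibniz,
    mkDerivation_X]
  simp only [smul_eq_mul]
  ring

/-! ### Descent to p_1 = 1 -/

/-- The specialization `p_k ↦ q_{k-1}`. -/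
def specialize : SymAlg →ₐ[ℝ] MomentAlg := momentInv.comp circ

theorem specialize_X (k : ℕ+) : specialize (X k) = q k.natPred := momentInv_circ k

theorem specialize_psum_succ (k : ℕ) : specialize (psum (k + 1)) = q k := by
  rw [psum, specialize_X, Nat.natPred_succPNat]

theorem specialize_C (a : ℝ) : specialize (C a) = C a := algHom_C specialize a

theorem specialize_X_one : specialize (X 1) = 1 := specialize_X 1

theorem specialize_X_add_one (n : ℕ+) : specialize (X (n + 1)) = X n := by
  rw [← psum_coe, PNat.add_coe, PNat.one_coe, specialize_psum_succ]
  conv_lhs => rw [← PNat.natPred_add_one n]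
  rw [q, PNat.succPNat_natPred]

theorem q_coe (n : ℕ+) : q n = X n := by
  rw [← specialize_psum_succ, ← specialize_X_add_one, ← psum_coe]
  rfl

theorem pnat_eq_one_or_add_one (k : ℕ+) : k = 1 ∨ ∃ n : ℕ+, k = n + 1 := by
  by_cases h : k = 1
  · exact Or.inl h
  · exact Or.inr (PNat.exists_eq_succ_of_ne_one h)

/-- The multiple of E corrects the derivation so that it kills p_1 after specialization and hence
descends. It also creates the products −q_n q_m in `momentCoeff`. -/
theorem specialize_symDer (n : ℕ+) (f : SymAlg) :
    specialize (symDer (n + 1) f) - C ((n : ℝ) + 1) * X n * specialize (eulerOp f) =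
      mkDerivation ℝ (momentCoeff n) (specialize f) := by
  induction f using MvPolynomial.induction_on with
  | C a => simp only [derivation_C, specialize_C, map_zero, mul_zero, sub_zero]
  | add f g hf hg =>
    simp only [map_add] at hf hg ⊢
    rw [← hf, ← hg]
    ring
  | mul_X f k ih =>
    have hsym : specialize (symCoeff (n + 1) k) =
        C ((n : ℝ) + 1) * C (k : ℝ) * q (n + k.natPred) := by
      have e : ((n + 1 : ℕ+) : ℕ) + k - 1 = (n + k.natPred) + 1 := by
        have := PNat.natPred_add_one k
        rw [PNat.add_coe, PNat.one_coe]
        omega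
      rw [symCoeff, e, map_smul, specialize_psum_succ, smul_eq_C_mul, C_mul, PNat.add_coe,
        PNat.one_coe]
      push_cast
      rfl
    have hmain : specialize (symCoeff (n + 1) k) - C ((n : ℝ) + 1) * X n *
        (C (k : ℝ) * specialize (X k)) = mkDerivation ℝ (momentCoeff n) (specialize (X k)) := by
      rw [hsym]
      rcases pnat_eq_one_or_add_one k with rfl | ⟨m, rfl⟩
      · rw [specialize_X_one, Derivation.map_one_eq_zero, show PNat.natPred 1 = 0 from rfl,
          add_zero, q_coe]
        ring
      · rw [specialize_X_add_one, mkDerivation_X, momentCoeff, q_coe, q_coe,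
          show PNat.natPred (m + 1) = m from by
            have := PNat.natPred_add_one (m + 1); rw [PNat.add_coe, PNat.one_coe] at this; omega,
          C_mul, PNat.add_coe, PNat.one_coe]
        push_cast
        ring
    rw [map_mul specialize f, Derivation.leibniz, Derivation.leibniz, Derivation.leibniz, eulerOp_X, ← hmain,
      ← ih, symDer, mkDerivation_X]
    simp only [smul_eq_mul, map_add, map_mul, specialize_C]
    ring

/-- The surplus multiple of q_n is exactly what −E² + (1 − t)E cancels on p_{n+1}. -/
theorem specialize_drift (s t : ℝ) (n : ℕ+) :
    specialize (drift s t (n + 1)) = momentDrift s t n +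
      (C (((n : ℝ) + 1) ^ 2) - C (1 - t) * C ((n : ℝ) + 1)) * X n := by
  obtain ⟨r, hr⟩ : ∃ r : ℕ, (n : ℕ) = r + 1 := ⟨n.natPred, (PNat.natPred_add_one n).symm⟩
  have hquad : quadCoeff n =
      C ((n : ℝ) + 1) * ∑ k ∈ Finset.range r, q k * q (r - 1 - k) := by
    rw [quadCoeff, hr]
    cases r with
    | zero => simp
    | succ r =>
      rw [if_neg (by omega), Finset.Nat.sum_antidiagonal_eq_sum_range_succ_mk]
      rfl
  have hsum : ∀ k ∈ Finset.range r,
      specialize (psum (k + 1) * psum (r - k)) = q k * q (r - 1 - k) := by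
    intro k hk
    have := Finset.mem_range.mp hk
    rw [map_mul, specialize_psum_succ, show r - k = r - 1 - k + 1 by omega, specialize_psum_succ]
  rw [drift_succ_succ s t (n + 1) r (by rw [PNat.add_coe, hr, PNat.one_coe]), map_mul, map_add,
    map_sum, Finset.sum_congr rfl hsum, map_mul, specialize_C, specialize_C, specialize_psum_succ,
    momentDrift, hquad, PNat.add_coe, PNat.one_coe, q_coe, hr, Nat.add_sub_cancel]
  simp only [C_add, C_mul, C_pow, C_sub, C_1, Nat.cast_add, Nat.cast_one]
  ring

/-- The lift of the operator to the algebra of symmetric functions. -/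
def lift (s t : ℝ) (f : SymAlg) : SymAlg :=
  lowering s t f - eulerOp (eulerOp f) + C (1 - t) * eulerOp f

/-- Both sides are compared under multiplication by p_k: the case k = 1 says that the lift respects
p_1 = 1, and k > 1 matches the product rule in the moment coordinates. -/
theorem specialize_lift (z z' : ℂ) (f : SymAlg) :
    specialize (lift (z + z').re (z * z').re f) = diffOp z z' (specialize f) := by
  induction f using MvPolynomial.induction_on with
  | C a =>
    rw [lift, specialize_C, diffOp_eq, lowering_C, derivation_C, derivation_C, secondOrder_C,
      map_zero, sub_zero, mul_zero, add_zero, map_zero]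
  | add f g hf hg =>
    have h : lift (z + z').re (z * z').re (f + g) =
        lift (z + z').re (z * z').re f + lift (z + z').re (z * z').re g := by
      simp only [lift, map_add]
      ring
    have h' : diffOp z z' (specialize f + specialize g) =
        diffOp z z' (specialize f) + diffOp z z' (specialize g) := by
      simp only [← diffOpLinear_apply, map_add]
    rw [h, map_add specialize f g, h', ← hf, ← hg, map_add]
  | mul_X f k ih =>
    rw [map_mul specialize f]
    have he : eulerOp (f * X k) = X k * eulerOp f + C (k : ℝ) * X k * f := by
      rw [Derivation.leibniz, eulerOp_X, smul_eq_mul, smul_eq_mul]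
      ring
    have hee : eulerOp (eulerOp (f * X k)) = X k * eulerOp (eulerOp f) +
        2 * (C (k : ℝ) * X k * eulerOp f) + C ((k : ℝ) ^ 2) * X k * f := by
      rw [he, map_add, Derivation.leibniz, Derivation.leibniz, Derivation.leibniz, derivation_C,
        eulerOp_X, C_pow]
      simp only [smul_eq_mul]
      ring
    rw [lift, lowering_mul_X, hee, he]
    rw [lift] at ih
    simp only [map_add, map_sub, map_mul, specialize_C, map_ofNat] at ih ⊢
    rcases pnat_eq_one_or_add_one k with rfl | ⟨n, rfl⟩
    -- The multiples of `f` sum to t − 1 + (1 − t) = 0, and the cross term 2E from L cancels the one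
    -- from −E².
    · rw [specialize_X_one, mul_one (specialize f), ← ih, symDer_one, drift_one, specialize_C]
      simp only [PNat.one_coe, Nat.cast_one, C_1, one_pow]
      ring
    · rw [specialize_X_add_one, diffOp_mul_X, ← specialize_symDer, ← ih, specialize_drift]
      simp only [PNat.add_coe, PNat.one_coe, Nat.cast_add, Nat.cast_one, C_sub, C_1, C_add, C_pow]
      ring

/-! ### Existence and uniqueness on the quotient -/

theorem momentEquiv_specialize (f : SymAlg) : momentEquiv (specialize f) = circ f :=
  momentEquiv.apply_symm_apply (circ f)

theorem circ_surjective : Function.Surjective circ := Ideal.Quotient.mkₐ_surjective ℝ circIdeal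

theorem span_circ_schur : Submodule.span ℝ (Set.range fun μ => circ (schur μ)) = ⊤ := by
  have h : (Set.range fun μ => circ (schur μ)) = circ.toLinearMap '' Set.range schur := by
    rw [← Set.range_comp]
    rfl
  rw [h, ← Submodule.map_span, span_schur_eq_top, Submodule.map_top, LinearMap.range_eq_top]
  exact circ_surjective

theorem IsPreGenerator.unique {z z' : ℂ} {A B : SymCirc →ₗ[ℝ] SymCirc}
    (hA : IsPreGenerator z z' A) (hB : IsPreGenerator z z' B) : A = B := by
  refine LinearMap.ext_on_range span_circ_schur fun μ => ?_
  rw [hA μ, hB μ]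

/-- The operator on the quotient algebra that is given by `diffOp` in moment coordinates. -/
def preGenerator (z z' : ℂ) : SymCirc →ₗ[ℝ] SymCirc :=
  momentEquiv.toLinearMap ∘ₗ diffOpLinear z z' ∘ₗ momentEquiv.symm.toLinearMap

theorem preGenerator_momentEquiv (z z' : ℂ) (F : MomentAlg) :
    preGenerator z z' (momentEquiv F) = momentEquiv (diffOp z z' F) := by
  simp [preGenerator, diffOpLinear_apply]

/-- The diagonal coefficient is −m² + (1 − t)m = −m(m − 1 + t), read off from the lift on a
homogeneous Schur function. -/
theorem isPreGenerator_preGenerator (z z' : ℂ) : IsPreGenerator z z' (preGenerator z z') := by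
  intro μ
  have he : eulerOp (schur μ) = (μ.card : ℝ) • schur μ := by rw [eulerOp_schur, smul_eq_C_mul]
  rw [← momentEquiv_specialize (schur μ), preGenerator_momentEquiv, ← specialize_lift,
    momentEquiv_specialize, momentEquiv_specialize, lift, lowering_schur, he, Derivation.map_smul,
    he, ← smul_eq_C_mul]
  simp only [map_add circ, map_sub circ, map_sum circ, map_smul circ]
  module

end

end ThomaDiffusion

theorem theorem6p1 (z z' : ℂ) (hsum : (z + z').im = 0) (hprod : (z * z').im = 0) :
    (∃! A : ThomaDiffusion.SymCirc →ₗ[ℝ] ThomaDiffusion.SymCirc,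
        ThomaDiffusion.IsPreGenerator z z' A) ∧
      ∀ A : ThomaDiffusion.SymCirc →ₗ[ℝ] ThomaDiffusion.SymCirc,
        ThomaDiffusion.IsPreGenerator z z' A →
          ∀ F : ThomaDiffusion.MomentAlg,
            A (ThomaDiffusion.momentEquiv F) =
              ThomaDiffusion.momentEquiv (ThomaDiffusion.diffOp z z' F) := by
  refine ⟨⟨ThomaDiffusion.preGenerator z z', ThomaDiffusion.isPreGenerator_preGenerator z z',
    fun A hA => hA.unique (ThomaDiffusion.isPreGenerator_preGenerator z z')⟩, fun A hA F => ?_⟩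
  rw [hA.unique (ThomaDiffusion.isPreGenerator_preGenerator z z'),
    ThomaDiffusion.preGenerator_momentEquiv]
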